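/- Let $N\ge 2$, $L\ge N$ be integers, $\Delta>0$, $\alpha\in(0,1)$, and let $v_1,\dots,v_N$ be the vertices of a ring, indices modulo $N$. A state is a vector $\mathbf q=(q_1,\dots,q_N)$ of positive integer multiples of $\Delta$ with $\sum_i q_i=L\Delta$; $\mathcal S$ is the set of states, and $\mathcal S_L=\{\mathbf q\in\mathcal S:\ |q_i-q_j|\le\Delta\ \text{for all } i,j\}$ is the set of TDM states. At each event $n=0,1,2,\dots$ one edge is active, and if $(v_i,v_{i+1})$ is active at event $n$ then $(v_{i-1},v_i)$ is active at event $n+1$. An interaction along the active edge $(v_i,v_{i+1})$ replaces $$q_i'=\mathcal Q\Big(\tfrac{1+\alpha}{2}q_i+\tfrac{1-\alpha}{2}q_{i+1}\Big),\qquad q_{i+1}'=q_i+q_{i+1}-q_i',$$ and leaves the other values unchanged, where $\mathcal Q(x)$ is the point of $\{0,\Delta,\dots,(L-1)\Delta\}$ nearest to $x+\mathbf v$ and the dithers $\mathbf v$ used at the successive events are independent and uniform on $(-\Delta/2,\Delta/2)$. The interaction is a compression if $|q_i'-q_{i+1}'|<|q_i-q_{i+1}|$. For $n_0\ge 0$,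 start the process at event $n_0$ in state $\mathbf q$. Let $T(\mathbf q,n_0)$ be the number of interactions until the state is in $\mathcal S_L$, and $T_1(\mathbf q,n_0)$ the number of interactions up to and including the first compression; put $\bar T(n_0)=\max_{\mathbf q\in\mathcal S\setminus\mathcal S_L}\mathbb E[T_1(\mathbf q,n_0)]$ (with $\bar T(n_0)=0$ if $\mathcal S=\mathcal S_L$). Let $V(\mathbf q)=\|\mathbf q-\bar q\mathbf 1\|^2/\Delta^2$ with $\bar q=\frac1N\sum_i q_i$ and the Euclidean norm, and $g(\alpha)=\frac{1+\alpha}{24(1-\alpha)}$. Then: 1. $V(\mathbf q)\le (L-N)^2N/4$ for every $\mathbf q\in\mathcal S$. 2. For every $\mathbf q\in\mathcal S$, every active edge $(v_i,v_{i+1})$ and every value of the dither in $(-\Delta/2,\Delta/2)$: if the interaction is a compression then $V(\mathbf q')\le V(\mathbf q)-2$; otherwise $V(\mathbf q')=V(\mathbf q)$; and if $|q_i-q_{i+1}|\le\Delta$, it is not a compression. 3. For every initial active edge and every $n_0$, $$\max_{\mathbf q\in\mathcal S}\mathbb E[T(\mathbf q,n_0)]\le \bar T(n_0)\,(L-N)^2N/8.$$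 4. There is an absolute constant $C>0$ such that for all $N\ge2$, $L\ge N$, $\Delta>0$, $\alpha\in(0,1)$, every initial active edge and every $n_0$, $$\bar T(n_0)\le C\,g(\alpha)N^3\qquad\text{and}\qquad \max_{\mathbf q\in\mathcal S}\mathbb E[T(\mathbf q,n_0)]\le C\,g(\alpha)(L-N)^2N^4/8 .$$ -/

import Mathlib

open MeasureTheory ProbabilityTheory
open scoped ENNReal

noncomputable section

namespace D3sync

/-- The dithered quantizer onto the grid `{0, Δ, …, (L - 1)Δ}`: the grid point nearest to `x + v`,
where `v` is the value of the dither (midpoints, met with probability zero, are rounded up). -/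
def quantize (L : ℕ) (Δ x v : ℝ) : ℝ :=
  ((max 0 (min ((L : ℤ) - 1) (round ((x + v) / Δ))) : ℤ) : ℝ) * Δ

/-- The quantizer does return a grid point at minimal distance from `x + v`. -/
theorem quantize_nearest (L : ℕ) (hL : 0 < L) (Δ x v : ℝ) (hΔ : 0 < Δ) :
    (∃ j : ℕ, j < L ∧ quantize L Δ x v = j * Δ) ∧
      ∀ j : ℕ, j < L → |quantize L Δ x v - (x + v)| ≤ |(j : ℝ) * Δ - (x + v)| := by
  set m : ℤ := max 0 (min ((L : ℤ) - 1) (round ((x + v) / Δ))) with hm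
  have hq : quantize L Δ x v = (m : ℝ) * Δ := rfl
  have hm0 : 0 ≤ m := le_max_left _ _
  have hmL : m < L := by omega
  refine ⟨⟨m.toNat, by omega, ?_⟩, fun j hj => ?_⟩
  · rw [hq]
    congr 1
    exact_mod_cast (Int.toNat_of_nonneg hm0).symm
  · rw [hq]
    set y := (x + v) / Δ with hy
    have hxy : x + v = y * Δ := by rw [hy]; field_simp
    rw [hxy, ← sub_mul, ← sub_mul, abs_mul, abs_mul]
    refine mul_le_mul_of_nonneg_right ?_ (abs_nonneg _)
    have h1 := Int.floor_le (y + 1 / 2)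
    have h2 := Int.lt_floor_add_one (y + 1 / 2)
    rw [← round_eq] at h1 h2
    have hcase : ((j : ℤ) = m) ∨ ((j : ℤ) + 1 ≤ m ∧ m ≤ round y) ∨
        (m + 1 ≤ (j : ℤ) ∧ round y ≤ m) := by omega
    rcases hcase with h | ⟨h, h'⟩ | ⟨h, h'⟩
    · have : (j : ℝ) = (m : ℝ) := by exact_mod_cast h
      rw [this]
    · have a : (j : ℝ) + 1 ≤ m := by exact_mod_cast h
      have b : (m : ℝ) ≤ round y := by exact_mod_cast h'
      rw [abs_le]
      constructor <;> cases abs_cases ((j : ℝ) - y) <;> linarith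
    · have a : (m : ℝ) + 1 ≤ j := by exact_mod_cast h
      have b : (round y : ℝ) ≤ m := by exact_mod_cast h'
      rw [abs_le]
      constructor <;> cases abs_cases ((j : ℝ) - y) <;> linarith

variable {N : ℕ} [NeZero N]

/-- One interaction along the edge `(v_i, v_{i+1})` of the ring, with dither value `v`. Vertices are
numbered modulo `N`. -/
def step (L : ℕ) (Δ α : ℝ) (i : ZMod N) (v : ℝ) (q : ZMod N → ℝ) : ZMod N → ℝ :=
  let q' := quantize L Δ ((1 + α) / 2 * q i + (1 - α) / 2 * q (i + 1)) v
  Function.update (Function.update q i q') (i + 1) (q i + q (i + 1) - q')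

/-- The states: every value is a positive multiple of `Δ`, and the values add up to `LΔ`. -/
def states (N : ℕ) [NeZero N] (L : ℕ) (Δ : ℝ) : Set (ZMod N → ℝ) :=
  {q | (∀ i, ∃ j : ℕ, q i = j * Δ) ∧ (∀ i, Δ ≤ q i) ∧ ∑ i, q i = L * Δ}

/-- The TDM states: any two values differ by at most one slot. -/
def tdmStates (N : ℕ) [NeZero N] (L : ℕ) (Δ : ℝ) : Set (ZMod N → ℝ) :=
  {q | q ∈ states N L Δ ∧ ∀ i j, |q i - q j| ≤ Δ}

/-- An interaction along `(v_i, v_{i+1})` turning `q` into `q'` is a compression. -/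
def IsCompression (i : ZMod N) (q q' : ZMod N → ℝ) : Prop :=
  |q' i - q' (i + 1)| < |q i - q (i + 1)|

/-- The potential function `‖q - q̄ 1‖² / Δ²` with the Euclidean norm, `q̄` being the mean of `q`. -/
def potential (Δ : ℝ) (q : ZMod N → ℝ) : ℝ :=
  (∑ i, (q i - (∑ j, q j) / N) ^ 2) / Δ ^ 2

/-- At event `n` the active edge is `(v_i, v_{i+1})` with `i = e - n`: it starts at `i = e` and
moves down by one at each event. -/
def activeIndex (e : ZMod N) (n : ℕ) : ZMod N := e - n

variable {Ω : Type*}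

/-- The state after `k` interactions, when the state at event `n₀` is `q₀`; `v n` is the dither
used at event `n`. -/
def run (L : ℕ) (Δ α : ℝ) (e : ZMod N) (v : ℕ → Ω → ℝ) (n₀ : ℕ) (q₀ : ZMod N → ℝ) :
    ℕ → Ω → ZMod N → ℝ
  | 0, _ => q₀
  | k + 1, ω =>
      step L Δ α (activeIndex e (n₀ + k)) (v (n₀ + k) ω) (run L Δ α e v n₀ q₀ k ω)

/-- The number of interactions, from event `n₀` and state `q₀` on, until a TDM state is reached
(`∞` if this never happens). -/
def absorptionTime (L : ℕ) (Δ α : ℝ) (e : ZMod N) (v : ℕ → Ω → ℝ) (n₀ : ℕ) (q₀ : ZMod N → ℝ)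
    (ω : Ω) : ℝ≥0∞ :=
  ⨅ (k : ℕ) (_ : run L Δ α e v n₀ q₀ k ω ∈ tdmStates N L Δ), (k : ℝ≥0∞)

/-- The number of interactions, from event `n₀` and state `q₀` on, up to and including the first
compression (`∞` if there is none). -/
def compressionTime (L : ℕ) (Δ α : ℝ) (e : ZMod N) (v : ℕ → Ω → ℝ) (n₀ : ℕ) (q₀ : ZMod N → ℝ)
    (ω : Ω) : ℝ≥0∞ :=
  ⨅ (k : ℕ) (_ : IsCompression (activeIndex e (n₀ + k)) (run L Δ α e v n₀ q₀ k ω)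
      (run L Δ α e v n₀ q₀ (k + 1) ω)), ((k + 1 : ℕ) : ℝ≥0∞)

/-- The largest expected absorption time, over all initial states. -/
def maxAbsorption [MeasurableSpace Ω] (P : Measure Ω) (L : ℕ) (Δ α : ℝ) (e : ZMod N)
    (v : ℕ → Ω → ℝ) (n₀ : ℕ) : ℝ≥0∞ :=
  ⨆ q ∈ states N L Δ, ∫⁻ ω, absorptionTime L Δ α e v n₀ q ω ∂P

/-- The largest expected number of interactions until the next compression, over all states that
are not TDM states (from a TDM state no compression can happen). -/
def maxCompression [MeasurableSpace Ω] (P : Measure Ω) (L : ℕ) (Δ α : ℝ) (e : ZMod N)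
    (v : ℕ → Ω → ℝ) (n₀ : ℕ) : ℝ≥0∞ :=
  ⨆ q ∈ states N L Δ \ tdmStates N L Δ, ∫⁻ ω, compressionTime L Δ α e v n₀ q ω ∂P

/-- The dithers are independent and uniformly distributed on `(-Δ/2, Δ/2)`. -/
structure IsDither [MeasurableSpace Ω] (P : Measure Ω) (Δ : ℝ) (v : ℕ → Ω → ℝ) : Prop where
  measurable : ∀ n, Measurable (v n)
  indep : iIndepFun v P
  uniform : ∀ n, pdf.IsUniform (v n) (Set.Ioo (-(Δ / 2)) (Δ / 2)) P

/-- The constant `g(α)`. -/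
def g (α : ℝ) : ℝ := (α + 1) / (24 * (1 - α))

end D3sync

end

open MeasureTheory ProbabilityTheory
open scoped ENNReal

noncomputable section

namespace D3sync

/-! ### Stopping times of inhomogeneous Markov chains driven by independent inputs -/

section Chain

variable {S Ω : Type*}

/-! Divided by `Δ`, a state is a vector of positive integers with sum `L`. An interaction of values
`a, b` replaces `a` by `m = ⌊a + (1-α)/2 * (b-a) + w⌋`, with `w` uniform on `(0,1)`, an integer
between `a` and `b`. The sum of squares changes by `2(m-a)(m-b)`: this is zero if the two values
stay or are exchanged, and at most `-2` if `m` lies strictly between them, which is exactly a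
compression.

All expected times are bounded by one Lyapunov criterion, `expTime_le`. For absorption, let `T`
bound the expected time to a compression from every non-TDM state and every event. The function
`T(V-2)/2 + E[T₁]` falls by at least one per event on average: between compressions the second term
does so, and at a compression the first term releases the `T` that pays for restarting the second
(`expTime_reachesTdm_le`). Rotating the ring along with the active edge shows that the worst `E[T₁]`
does not depend on the starting event.

For the cubic bound, two values differing by at least two are followed as tokens. Put `p = (1-α)/2`.
Neighbours differing by one are exchanged with probability `p`; equal neighbours may be regarded as
exchanged with the same probability; neighbours differing by two or more escape compression with
probability at most `α = 1 - 2p`, and are then unchanged. Seen from the active edge, a token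
advances by one per event, apart from exchanges. Moving the position `1` to `1 - r`, with `r =
(1-α)/(1+α)`, makes the mean advance exactly one. The gap `D` of the tokens then has mean-zero
increments, up to wrap-around, of variance `r` whenever exactly one token is at the active edge. So
`D(N-D)`, which is blind to wrap-around, loses `r` there on average; the factor `N/r` turns this
into `N`, enough to pay for a whole turn of the ring, and `returnTime` spreads the payment over the
turn. When both tokens are at the active edge, an added constant `1/(1-α)` pays for the attempts
that fail to compress. The resulting function is of order `N³/(1-α)` (`tokenFun_drift`,
`tokenFun_kill`, `spreadFun_drift`). -/

/-- The trajectory of the chain with update maps `F`, driven by the input `w` from time `n` on. -/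
def traj (F : ℕ → ℝ → S → S) (w : ℕ → ℝ) (n : ℕ) (x : S) : ℕ → S
  | 0 => x
  | k + 1 => F (n + k) (w (n + k)) (traj F w n x k)

/-- The definition unrolls the last transition; first-step analysis needs the first one. -/
theorem traj_succ' (F : ℕ → ℝ → S → S) (w : ℕ → ℝ) (n : ℕ) (x : S) (k : ℕ) :
    traj F w n x (k + 1) = traj F w (n + 1) (F n (w n) x) k := by
  induction k with
  | zero => simp [traj]
  | succ k ih => rw [traj, ih, traj, Nat.add_assoc n 1 k, Nat.add_comm 1 k]

/-- The number of transitions up to and including the first one with the property `halt`. -/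
def stopTime (F : ℕ → ℝ → S → S) (halt : ℕ → S → S → Prop) (w : ℕ → ℝ) (n : ℕ) (x : S) : ℝ≥0∞ :=
  ⨅ (k : ℕ) (_ : halt (n + k) (traj F w n x k) (traj F w n x (k + 1))), ((k + 1 : ℕ) : ℝ≥0∞)

open Classical in
/-- The indicator of the event that none of the first `k` transitions has the property `halt`. -/
def survives (F : ℕ → ℝ → S → S) (halt : ℕ → S → S → Prop) (w : ℕ → ℝ) : ℕ → ℕ → S → ℝ≥0∞
  | 0, _, _ => 1
  | k + 1, n, x =>
      if halt n x (F n (w n) x) then 0 else survives F halt w k (n + 1) (F n (w n) x)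

open Classical in
/-- The function equal to `f` at the successors of `x` reached without stopping, and to `0`
elsewhere. -/
def kill (halt : ℕ → S → S → Prop) (n : ℕ) (x : S) (f : S → ℝ≥0∞) (y : S) : ℝ≥0∞ :=
  if halt n x y then 0 else f y

/-- The probability that none of the first `k` transitions has the property `halt`, for independent
inputs with law `ν`. -/
def survival (F : ℕ → ℝ → S → S) (halt : ℕ → S → S → Prop) (ν : Measure ℝ) : ℕ → ℕ → S → ℝ≥0∞
  | 0, _, _ => 1
  | k + 1, n, x => ∫⁻ u, kill halt n x (survival F halt ν k (n + 1)) (F n u x) ∂ν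

/-- The expected stopping time, as the sum of the survival probabilities. -/
def expTime (F : ℕ → ℝ → S → S) (halt : ℕ → S → S → Prop) (ν : Measure ℝ) (n : ℕ) (x : S) : ℝ≥0∞ :=
  ∑' k, survival F halt ν k n x

open Classical in
theorem survives_eq (F : ℕ → ℝ → S → S) (halt : ℕ → S → S → Prop) (w : ℕ → ℝ) (k n : ℕ) (x : S) :
    survives F halt w k n x =
      if ∃ j < k, halt (n + j) (traj F w n x j) (traj F w n x (j + 1)) then 0 else 1 := by
  induction k generalizing n x with
  | zero => simp [survives]
  | succ k ih =>
    rw [survives, ih]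
    by_cases h : halt n x (F n (w n) x)
    · rw [if_pos h, if_pos ⟨0, by omega, by simpa [traj] using h⟩]
    · rw [if_neg h]
      congr 1
      refine propext ⟨?_, ?_⟩
      · rintro ⟨j, hj, hs⟩
        refine ⟨j + 1, by omega, ?_⟩
        rw [traj_succ', traj_succ' _ _ _ _ (j + 1), ← Nat.add_assoc, Nat.add_right_comm]
        exact hs
      · rintro ⟨j, hj, hs⟩
        cases j with
        | zero => exact absurd (by simpa [traj] using hs) h
        | succ j =>
          rw [traj_succ', traj_succ' _ _ _ _ (j + 1), ← Nat.add_assoc, Nat.add_right_comm] at hs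
          exact ⟨j, by omega, hs⟩

/-- A random time is the sum over `k` of the indicators that it exceeds `k`. If the chain never
stops, every term is one and both sides are `∞`. -/
theorem stopTime_eq_tsum (F : ℕ → ℝ → S → S) (halt : ℕ → S → S → Prop) (w : ℕ → ℝ) (n : ℕ) (x : S) :
    stopTime F halt w n x = ∑' k, survives F halt w k n x := by
  classical
  simp only [survives_eq]
  unfold stopTime
  by_cases h : ∃ j, halt (n + j) (traj F w n x j) (traj F w n x (j + 1))
  · have hiff : ∀ k, (∃ j < k, halt (n + j) (traj F w n x j) (traj F w n x (j + 1))) ↔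
        Nat.find h < k := fun k =>
      ⟨fun ⟨j, hj, hs⟩ => (Nat.find_min' h hs).trans_lt hj, fun hk => ⟨_, hk, Nat.find_spec h⟩⟩
    simp only [hiff]
    rw [tsum_eq_sum (s := Finset.range (Nat.find h + 1))]
    · rw [Finset.sum_congr rfl (g := fun _ => (1 : ℝ≥0∞))]
      · rw [Finset.sum_const, Finset.card_range, nsmul_one]
        refine le_antisymm (iInf₂_le (Nat.find h) (Nat.find_spec h)) (le_iInf₂ fun k hk => ?_)
        exact_mod_cast Nat.succ_le_succ (Nat.find_min' h hk)
      · intro k hk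
        rw [Finset.mem_range] at hk
        rw [if_neg (by omega)]
    · intro k hk
      rw [Finset.mem_range] at hk
      rw [if_pos (by omega)]
  · push Not at h
    have h' : ∀ k, ¬ ∃ j < k, halt (n + j) (traj F w n x j) (traj F w n x (j + 1)) :=
      fun k ⟨j, _, hs⟩ => h j hs
    simp only [h', if_false]
    simp only [h, iInf_false, iInf_top]
    exact (ENNReal.tsum_const_eq_top_of_ne_zero one_ne_zero).symm

/-- A symmetry `ρ` that conjugates the dynamics at time `n` to those at time `n + 1` absorbs the
time dependence of the chain. -/
theorem expTime_shift (F : ℕ → ℝ → S → S) (halt : ℕ → S → S → Prop) (ν : Measure ℝ) (ρ : S → S)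
    (hFρ : ∀ n u x, F (n + 1) u (ρ x) = ρ (F n u x))
    (h_halt : ∀ n x y, halt (n + 1) (ρ x) (ρ y) ↔ halt n x y) (n : ℕ) (x : S) :
    expTime F halt ν (n + 1) (ρ x) = expTime F halt ν n x := by
  refine tsum_congr fun k => ?_
  induction k generalizing n x with
  | zero => rfl
  | succ k ih =>
    refine lintegral_congr fun u => ?_
    rw [hFρ]
    unfold kill
    rw [ih]
    by_cases h : halt n x (F n u x)
    · rw [if_pos h, if_pos ((h_halt _ _ _).2 h)]
    · rw [if_neg h, if_neg (mt (h_halt _ _ _).1 h)]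

variable [MeasurableSpace S] [DiscreteMeasurableSpace S] {F : ℕ → ℝ → S → S}

/-- Survival from time `n` on depends only on the inputs from time `n` on. This form of
measurability is what makes it independent of earlier inputs. -/
theorem measurable_survives_iSup [Countable S] (hF : ∀ n x, Measurable fun u => F n u x)
    (halt : ℕ → S → S → Prop) (v : ℕ → Ω → ℝ) (k n : ℕ) (x : S) :
    Measurable[⨆ m ∈ Set.Ici n, MeasurableSpace.comap (v m) inferInstance]
      fun ω => survives F halt (fun m => v m ω) k n x := by
  induction k generalizing n x with
  | zero => exact measurable_const
  | succ k ih =>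
    have hle : (⨆ m ∈ Set.Ici (n + 1), MeasurableSpace.comap (v m) inferInstance) ≤
        ⨆ m ∈ Set.Ici n, MeasurableSpace.comap (v m) (inferInstance : MeasurableSpace ℝ) :=
      biSup_mono fun m hm => (Nat.le_succ n).trans hm
    let _ : MeasurableSpace Ω :=
      ⨆ m ∈ Set.Ici n, MeasurableSpace.comap (v m) (inferInstance : MeasurableSpace ℝ)
    have hvn : Measurable (v n) :=
      Measurable.of_comap_le (le_biSup (fun m => MeasurableSpace.comap (v m)
        (inferInstance : MeasurableSpace ℝ)) (Set.mem_Ici.2 le_rfl))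
    have hg : Measurable fun ω => F n (v n ω) x := (hF n x).comp hvn
    have hpair : Measurable (Function.uncurry fun (ω : Ω) (y : S) =>
        kill halt n x (survives F halt (fun m => v m ω) k (n + 1)) y) := by
      refine measurable_from_prod_countable_left fun y => ?_
      simp only [Function.uncurry, kill]
      split_ifs
      · exact measurable_const
      · exact (ih (n + 1) y).mono hle le_rfl
    exact hpair.comp (measurable_id.prodMk hg)

theorem measurable_survives [Countable S] [MeasurableSpace Ω] (hF : ∀ n x, Measurable fun u => F n u x)
    (halt : ℕ → S → S → Prop) {v : ℕ → Ω → ℝ} (hv : ∀ n, Measurable (v n)) (k n : ℕ) (x : S) :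
    Measurable fun ω => survives F halt (fun m => v m ω) k n x :=
  (measurable_survives_iSup hF halt v k n x).mono
    (iSup₂_le fun m _ => (hv m).comap_le) le_rfl

/-- This is the Markov property: conditioning on the state after one transition leaves a factor that
involves only later inputs. -/
theorem lintegral_survives [Countable S] [MeasurableSpace Ω] {P : Measure Ω} {ν : Measure ℝ}
    (hF : ∀ n x, Measurable fun u => F n u x) (halt : ℕ → S → S → Prop) {v : ℕ → Ω → ℝ}
    [IsProbabilityMeasure P]
    (hv : ∀ n, Measurable (v n)) (hi : iIndepFun v P) (hν : ∀ n, P.map (v n) = ν) (k n : ℕ) (x : S) :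
    ∫⁻ ω, survives F halt (fun m => v m ω) k n x ∂P = survival F halt ν k n x := by
  classical
  induction k generalizing n x with
  | zero => simp [survives, survival]
  | succ k ih =>
    have hkill : ∀ y, Measurable fun u => if F n u x = y then kill halt n x (fun _ => 1) y else 0 :=
      fun y => (Measurable.of_discrete
        (f := fun z => if z = y then kill halt n x (fun _ => 1) y else 0)).comp (hF n x)
    -- Countability of the state space enters here: summing over the value `y` of the next state
    -- turns each term into a product of a function of `v n` and a function of the future.
    have hsplit : ∀ (f : S → ℝ≥0∞) (u : ℝ), kill halt n x f (F n u x) =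
        ∑' y, (if F n u x = y then kill halt n x (fun _ => 1) y else 0) * f y := by
      intro f u
      rw [tsum_eq_single (F n u x)]
      · simp only [if_true, kill]
        split_ifs <;> simp
      · intro y hy
        rw [if_neg hy.symm, zero_mul]
    have hleft : ∀ ω, survives F halt (fun m => v m ω) (k + 1) n x =
        kill halt n x (survives F halt (fun m => v m ω) k (n + 1)) (F n (v n ω) x) := fun ω => rfl
    simp only [hleft, survival, hsplit]
    have hmeas : ∀ y, Measurable fun ω =>
        (if F n (v n ω) x = y then kill halt n x (fun _ => 1) y else 0) *
          survives F halt (fun m => v m ω) k (n + 1) y := fun y =>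
      Measurable.mul ((hkill y).comp (hv n)) (measurable_survives hF halt hv k (n + 1) y)
    rw [lintegral_tsum fun y => (hmeas y).aemeasurable,
      lintegral_tsum fun y => ((hkill y).mul_const _).aemeasurable]
    refine tsum_congr fun y => ?_
    have hind : Indep (MeasurableSpace.comap (v n) inferInstance)
        (⨆ m ∈ Set.Ici (n + 1), MeasurableSpace.comap (v m) inferInstance) P := by
      have := indep_iSup_of_disjoint (fun m => (hv m).comap_le) hi
        (S := {n}) (T := Set.Ici (n + 1)) (by simp)
      simpa using this
    have h1 := lintegral_mul_eq_lintegral_mul_lintegral_of_independent_measurableSpace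
      (hv n).comap_le (iSup₂_le fun m _ => (hv m).comap_le) hind
      ((hkill y).comp (comap_measurable (v n)))
      (measurable_survives_iSup hF halt v k (n + 1) y)
    rw [lintegral_mul_const _ (hkill y), ← ih (n + 1) y, ← hν n, lintegral_map (hkill y) (hv n)]
    exact h1

theorem lintegral_stopTime [Countable S] [MeasurableSpace Ω] {P : Measure Ω} {ν : Measure ℝ}
    (hF : ∀ n x, Measurable fun u => F n u x) (halt : ℕ → S → S → Prop) {v : ℕ → Ω → ℝ}
    [IsProbabilityMeasure P]
    (hv : ∀ n, Measurable (v n)) (hi : iIndepFun v P) (hν : ∀ n, P.map (v n) = ν) (n : ℕ) (x : S) :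
    ∫⁻ ω, stopTime F halt (fun m => v m ω) n x ∂P = expTime F halt ν n x := by
  simp only [stopTime_eq_tsum]
  rw [lintegral_tsum fun k => (measurable_survives hF halt hv k n x).aemeasurable]
  exact tsum_congr fun k => lintegral_survives hF halt hv hi hν k n x

theorem measurable_kill (hF : ∀ n x, Measurable fun u => F n u x) (halt : ℕ → S → S → Prop)
    (f : S → ℝ≥0∞) (n : ℕ) (x : S) : Measurable fun u => kill halt n x f (F n u x) :=
  (Measurable.of_discrete (f := kill halt n x f)).comp (hF n x)

/-- First-step analysis of the expected stopping time. -/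
theorem expTime_eq (hF : ∀ n x, Measurable fun u => F n u x) (halt : ℕ → S → S → Prop)
    (ν : Measure ℝ) (n : ℕ) (x : S) :
    expTime F halt ν n x = 1 + ∫⁻ u, kill halt n x (expTime F halt ν (n + 1)) (F n u x) ∂ν := by
  have hk : ∀ u, kill halt n x (expTime F halt ν (n + 1)) (F n u x) =
      ∑' k, kill halt n x (survival F halt ν k (n + 1)) (F n u x) := by
    intro u
    simp only [kill, expTime]
    split_ifs <;> simp
  simp only [hk]
  rw [lintegral_tsum fun k => (measurable_kill hF halt _ n x).aemeasurable, expTime,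
    tsum_eq_zero_add' ENNReal.summable]
  rfl

/-- A function which decreases by one on average before stopping bounds the expected stopping
time. -/
theorem expTime_le (hF : ∀ n x, Measurable fun u => F n u x) (halt : ℕ → S → S → Prop)
    (ν : Measure ℝ) (Valid : S → Prop) (h : ℕ → S → ℝ≥0∞)
    (hValid : ∀ n x, Valid x → ∀ᵐ u ∂ν, ¬ halt n x (F n u x) → Valid (F n u x))
    (hh : ∀ n x, Valid x → 1 + ∫⁻ u, kill halt n x (h (n + 1)) (F n u x) ∂ν ≤ h n x)
    (n : ℕ) (x : S) (hx : Valid x) : expTime F halt ν n x ≤ h n x := by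
  rw [expTime, ENNReal.tsum_eq_iSup_nat]
  refine iSup_le fun K => ?_
  -- Induction on partial sums of survival probabilities needs no prior finiteness of the
  -- expectation.
  induction K generalizing n x with
  | zero => simp
  | succ K ih =>
    rw [Finset.sum_range_succ']
    simp only [survival]
    rw [← lintegral_finsetSum _ fun k _ => measurable_kill hF halt _ n x, add_comm]
    refine le_trans (add_le_add le_rfl (lintegral_mono_ae ?_)) (hh n x hx)
    filter_upwards [hValid n x hx] with u hu
    unfold kill
    split_ifs with hs
    · simp
    · exact ih (n + 1) _ (hu hs)

end Chain

/-! ### The ring dynamics in integer slot counts -/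

section RingChain

variable {N : ℕ} [NeZero N] {L : ℕ} {Δ α : ℝ}

/-- The state whose values are the multiples `X i` of the slot width. -/
def scale (Δ : ℝ) (X : ZMod N → ℤ) : ZMod N → ℝ := fun i => X i * Δ

/-- One interaction, in units of the slot width. -/
def slotStep (L : ℕ) (Δ α : ℝ) (i : ZMod N) (v : ℝ) (X : ZMod N → ℤ) : ZMod N → ℤ :=
  let m : ℤ := max 0 (min ((L : ℤ) - 1)
    (round (((1 + α) / 2 * (X i * Δ) + (1 - α) / 2 * (X (i + 1) * Δ) + v) / Δ)))
  Function.update (Function.update X i m) (i + 1) (X i + X (i + 1) - m)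

omit [NeZero N] in
theorem step_scale (L : ℕ) (Δ α : ℝ) (i : ZMod N) (v : ℝ) (X : ZMod N → ℤ) :
    step L Δ α i v (scale Δ X) = scale Δ (slotStep L Δ α i v X) := by
  funext j
  simp only [step, scale, slotStep, quantize]
  by_cases h1 : j = i + 1
  · subst h1
    simp only [Function.update_self]
    push_cast
    ring
  · rw [Function.update_of_ne h1, Function.update_of_ne h1]
    by_cases h2 : j = i
    · subst h2
      simp only [Function.update_self]
    · rw [Function.update_of_ne h2, Function.update_of_ne h2]
      rfl

/-- The vectors of slot counts of the states. -/
def IsSlotState (L : ℕ) (X : ZMod N → ℤ) : Prop := (∀ i, 1 ≤ X i) ∧ ∑ i, X i = L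

theorem scale_mem_states (hΔ : 0 < Δ) (X : ZMod N → ℤ) :
    scale Δ X ∈ states N L Δ ↔ IsSlotState L X := by
  constructor
  · rintro ⟨-, h2, h3⟩
    refine ⟨fun i => ?_, ?_⟩
    · have := h2 i
      have h : (1 : ℝ) ≤ X i := by
        refine le_of_mul_le_mul_right ?_ hΔ
        simpa [scale] using this
      exact_mod_cast h
    · simp only [scale] at h3
      rw [← Finset.sum_mul] at h3
      have h := mul_right_cancel₀ hΔ.ne' h3
      exact_mod_cast h
  · rintro ⟨h1, h2⟩
    refine ⟨fun i => ⟨(X i).toNat, ?_⟩, fun i => ?_, ?_⟩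
    · have : ((X i).toNat : ℤ) = X i := Int.toNat_of_nonneg (by linarith [h1 i])
      simp only [scale]
      congr 1
      exact_mod_cast this.symm
    · have : (1 : ℝ) ≤ X i := by exact_mod_cast h1 i
      simp only [scale]
      nlinarith
    · simp only [scale]
      rw [← Finset.sum_mul]
      congr 1
      exact_mod_cast h2

theorem exists_scale_eq {q : ZMod N → ℝ} (hΔ : 0 < Δ) (hq : q ∈ states N L Δ) :
    ∃ X : ZMod N → ℤ, IsSlotState L X ∧ q = scale Δ X := by
  choose f hf using hq.1
  have h : q = scale Δ fun i => (f i : ℤ) := by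
    funext i
    simp [scale, hf i]
  exact ⟨_, (scale_mem_states hΔ _).1 (h ▸ hq), h⟩

/-- The vectors of slot counts of the TDM states. -/
def IsSlotTdm (L : ℕ) (X : ZMod N → ℤ) : Prop := IsSlotState L X ∧ ∀ i j, |X i - X j| ≤ 1

omit [NeZero N] in
theorem abs_scale_sub (hΔ : 0 < Δ) (X : ZMod N → ℤ) (i j : ZMod N) :
    |scale Δ X i - scale Δ X j| = ((|X i - X j| : ℤ) : ℝ) * Δ := by
  rw [scale, scale, ← sub_mul, abs_mul, abs_of_pos hΔ]
  push_cast
  rfl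

omit [NeZero N] in
theorem abs_scale_sub_le (hΔ : 0 < Δ) (X : ZMod N → ℤ) (i j : ZMod N) :
    |scale Δ X i - scale Δ X j| ≤ Δ ↔ |X i - X j| ≤ 1 := by
  rw [abs_scale_sub hΔ, mul_le_iff_le_one_left hΔ]
  exact_mod_cast Iff.rfl

theorem scale_mem_tdmStates (hΔ : 0 < Δ) (X : ZMod N → ℤ) :
    scale Δ X ∈ tdmStates N L Δ ↔ IsSlotTdm L X :=
  and_congr (scale_mem_states hΔ X) (forall₂_congr fun i j => abs_scale_sub_le hΔ X i j)

/-- The interaction along `(v_i, v_{i+1})` turning `X` into `Y` is a compression. -/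
def Compresses (i : ZMod N) (X Y : ZMod N → ℤ) : Prop := |Y i - Y (i + 1)| < |X i - X (i + 1)|

omit [NeZero N] in
theorem isCompression_scale (hΔ : 0 < Δ) (i : ZMod N) (X Y : ZMod N → ℤ) :
    IsCompression i (scale Δ X) (scale Δ Y) ↔ Compresses i X Y := by
  rw [IsCompression, abs_scale_sub hΔ, abs_scale_sub hΔ, mul_lt_mul_iff_left₀ hΔ, Compresses]
  exact_mod_cast Iff.rfl

omit [NeZero N] in
theorem ne_add_one (hN : 2 ≤ N) (i : ZMod N) : i ≠ i + 1 := by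
  have : Fact (1 < N) := ⟨hN⟩
  simp

theorem slot_add_le (hN : 2 ≤ N) {X : ZMod N → ℤ} (hX : IsSlotState L X) (i : ZMod N) :
    X i + X (i + 1) ≤ L := by
  rw [← hX.2, ← Finset.sum_pair (ne_add_one hN i)]
  exact Finset.sum_le_sum_of_subset_of_nonneg (Finset.subset_univ _)
    fun j _ _ => by linarith [hX.1 j]

/-- For dithers in `(-Δ/2, Δ/2)` the new value lies between the old values, and no clamping
occurs. -/
theorem slotStep_eq (hN : 2 ≤ N) (hΔ : 0 < Δ) (hα : 0 < α) (hα' : α < 1) {X : ZMod N → ℤ}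
    (hX : IsSlotState L X) (i : ZMod N) {v : ℝ} (hv : v ∈ Set.Ioo (-(Δ / 2)) (Δ / 2)) :
    ∃ m : ℤ, m = ⌊(X i : ℝ) + (1 - α) / 2 * (X (i + 1) - X i) + (v / Δ + 1 / 2)⌋ ∧
      min (X i) (X (i + 1)) ≤ m ∧ m ≤ max (X i) (X (i + 1)) ∧
      slotStep L Δ α i v X =
        Function.update (Function.update X i m) (i + 1) (X i + X (i + 1) - m) := by
  set a := X i with ha
  set b := X (i + 1) with hb
  have hw0 : 0 < v / Δ + 1 / 2 := by
    have : -(1 / 2) < v / Δ := by rw [lt_div_iff₀ hΔ]; linarith [hv.1]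
    linarith
  have hw1 : v / Δ + 1 / 2 < 1 := by
    have : v / Δ < 1 / 2 := by rw [div_lt_iff₀ hΔ]; linarith [hv.2]
    linarith
  set w := v / Δ + 1 / 2 with hw
  -- Rounding is the floor after adding one half; that half is put into `w`, which then lies in
  -- `(0,1)`.
  have hfl : round (((1 + α) / 2 * (a * Δ) + (1 - α) / 2 * (b * Δ) + v) / Δ) =
      ⌊(a : ℝ) + (1 - α) / 2 * (b - a) + w⌋ := by
    rw [round_eq]
    congr 1
    rw [hw]
    field_simp
    ring
  have hlo : min a b ≤ ⌊(a : ℝ) + (1 - α) / 2 * (b - a) + w⌋ := by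
    rw [Int.le_floor]
    rcases le_total a b with h | h
    · rw [min_eq_left h]
      have h' : (a : ℝ) ≤ b := by exact_mod_cast h
      nlinarith
    · rw [min_eq_right h]
      have h' : (b : ℝ) ≤ a := by exact_mod_cast h
      nlinarith
  have hhi : ⌊(a : ℝ) + (1 - α) / 2 * (b - a) + w⌋ ≤ max a b := by
    rw [← Int.lt_add_one_iff, Int.floor_lt]
    push_cast
    rcases le_total a b with h | h
    · have h' : (a : ℝ) ≤ b := by exact_mod_cast h
      rw [max_eq_right h']
      nlinarith
    · have h' : (b : ℝ) ≤ a := by exact_mod_cast h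
      rw [max_eq_left h']
      nlinarith
  refine ⟨_, rfl, hlo, hhi, ?_⟩
  have h1 := hX.1 i
  have h2 := hX.1 (i + 1)
  have h3 := slot_add_le hN hX i
  -- Both old values are at least one and their sum is at most `L`, so each is at most `L - 1`.
  have hclamp : max 0 (min ((L : ℤ) - 1) ⌊(a : ℝ) + (1 - α) / 2 * (b - a) + w⌋) =
      ⌊(a : ℝ) + (1 - α) / 2 * (b - a) + w⌋ := by omega
  unfold slotStep
  rw [← ha, ← hb, hfl, hclamp]

theorem sum_update_pair (hN : 2 ≤ N) (X : ZMod N → ℤ) (i : ZMod N) (c d : ℤ) (f : ℤ → ℤ) :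
    ∑ j, f (Function.update (Function.update X i c) (i + 1) d j) =
      ∑ j, f (X j) + (f c - f (X i) + (f d - f (X (i + 1)))) := by
  have hne := ne_add_one hN i
  rw [← sub_eq_iff_eq_add', ← Finset.sum_sub_distrib,
    ← Finset.sum_subset (Finset.subset_univ {i, i + 1})]
  · rw [Finset.sum_pair hne, Function.update_of_ne hne, Function.update_self, Function.update_self]
  · intro j _ hj
    simp only [Finset.mem_insert, Finset.mem_singleton, not_or] at hj
    rw [Function.update_of_ne hj.2, Function.update_of_ne hj.1, sub_self]

/-- The effect of one interaction: the value `X i` becomes some `m` between the two old values. -/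
theorem slotStep_cases (hN : 2 ≤ N) (hΔ : 0 < Δ) (hα : 0 < α) (hα' : α < 1) {X : ZMod N → ℤ}
    (hX : IsSlotState L X) (i : ZMod N) {v : ℝ} (hv : v ∈ Set.Ioo (-(Δ / 2)) (Δ / 2)) :
    IsSlotState L (slotStep L Δ α i v X) ∧
    (Compresses i X (slotStep L Δ α i v X) →
      2 ≤ |X i - X (i + 1)| ∧ ∑ j, slotStep L Δ α i v X j ^ 2 ≤ ∑ j, X j ^ 2 - 2) ∧
    (¬ Compresses i X (slotStep L Δ α i v X) →
      ∑ j, slotStep L Δ α i v X j ^ 2 = ∑ j, X j ^ 2) := by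
  obtain ⟨m, -, hlo, hhi, hs⟩ := slotStep_eq hN hΔ hα hα' hX i hv
  have hne := ne_add_one hN i
  rw [hs]
  have hsq := sum_update_pair hN X i m (X i + X (i + 1) - m) (fun z => z ^ 2)
  have hsum := sum_update_pair hN X i m (X i + X (i + 1) - m) (fun z => z)
  have h1 := hX.1 i
  have h2 := hX.1 (i + 1)
  refine ⟨⟨fun j => ?_, ?_⟩, ?_⟩
  · by_cases hj : j = i + 1
    · subst hj
      rw [Function.update_self]
      omega
    · rw [Function.update_of_ne hj]
      by_cases hj' : j = i
      · subst hj'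
        rw [Function.update_self]
        omega
      · rw [Function.update_of_ne hj']
        exact hX.1 j
  · rw [hsum, hX.2]
    ring
  · unfold Compresses
    rw [Function.update_self, Function.update_of_ne hne, Function.update_self, hsq]
    generalize X i = a at *
    generalize X (i + 1) = b at *
    have hid : m ^ 2 - a ^ 2 + ((a + b - m) ^ 2 - b ^ 2) = 2 * ((m - a) * (m - b)) := by ring
    rw [hid]
    constructor
    · intro hc
      have hcases : (a < m ∧ m < b) ∨ (b < m ∧ m < a) := by
        rcases abs_cases (m - (a + b - m)) with h | h <;> rcases abs_cases (a - b) with h' | h' <;>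
          omega
      refine ⟨?_, ?_⟩
      · rcases abs_cases (a - b) with h' | h' <;> omega
      · have : (m - a) * (m - b) ≤ -1 := by
          rcases hcases with h | h
          · nlinarith [mul_nonneg (show 0 ≤ m - a - 1 by omega) (show 0 ≤ b - m - 1 by omega)]
          · nlinarith [mul_nonneg (show 0 ≤ a - m - 1 by omega) (show 0 ≤ m - b - 1 by omega)]
        linarith
    · intro hc
      have hcases : m = a ∨ m = b := by
        rcases abs_cases (m - (a + b - m)) with h | h <;> rcases abs_cases (a - b) with h' | h' <;>
          omega
      rcases hcases with h | h <;> simp [h]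

omit [NeZero N] in
theorem update_pair_self (X : ZMod N → ℤ) (i : ZMod N) :
    Function.update (Function.update X i (X i)) (i + 1) (X i + X (i + 1) - X i) = X := by
  simp

-- A full exchange of the two values is a relabelling of vertices, so tokens can be followed through
-- it.
omit [NeZero N] in
theorem update_pair_swap (X : ZMod N → ℤ) (i : ZMod N) :
    Function.update (Function.update X i (X (i + 1))) (i + 1) (X i + X (i + 1) - X (i + 1)) =
      X ∘ Equiv.swap i (i + 1) := by
  funext j
  rw [Function.comp_apply]
  by_cases hj : j = i + 1
  · subst hj
    simp
  · rw [Function.update_of_ne hj]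
    by_cases hj' : j = i
    · subst hj'
      simp
    · rw [Function.update_of_ne hj', Equiv.swap_apply_of_ne_of_ne hj' hj]

/-- The uniform distribution on `(-Δ/2, Δ/2)`. -/
def ditherLaw (Δ : ℝ) : Measure ℝ := cond volume (Set.Ioo (-(Δ / 2)) (Δ / 2))

theorem isProbabilityMeasure_ditherLaw (hΔ : 0 < Δ) : IsProbabilityMeasure (ditherLaw Δ) := by
  refine cond_isProbabilityMeasure_of_finite ?_ ?_
  · rw [Real.volume_Ioo]
    simpa using hΔ
  · rw [Real.volume_Ioo]
    exact ENNReal.ofReal_ne_top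

theorem ae_ditherLaw (Δ : ℝ) : ∀ᵐ u ∂ditherLaw Δ, u ∈ Set.Ioo (-(Δ / 2)) (Δ / 2) :=
  ae_cond_mem measurableSet_Ioo

/-- In other words, `u/Δ + 1/2` is uniform on the unit interval. -/
theorem ditherLaw_lt (hΔ : 0 < Δ) {t : ℝ} (ht : 0 ≤ t) (ht' : t ≤ 1) :
    ditherLaw Δ {u | u / Δ + 1 / 2 < t} = ENNReal.ofReal t := by
  have hset : Set.Ioo (-(Δ / 2)) (Δ / 2) ∩ {u | u / Δ + 1 / 2 < t} =
      Set.Ioo (-(Δ / 2)) (t * Δ - Δ / 2) := by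
    ext u
    have : u / Δ + 1 / 2 < t ↔ u < t * Δ - Δ / 2 := by
      rw [← lt_sub_iff_add_lt, div_lt_iff₀ hΔ]
      constructor <;> intro h <;> linarith
    simp only [Set.mem_inter_iff, Set.mem_Ioo, Set.mem_ofPred_eq, this]
    constructor
    · rintro ⟨⟨h1, h2⟩, h3⟩
      exact ⟨h1, h3⟩
    · rintro ⟨h1, h2⟩
      exact ⟨⟨h1, by nlinarith⟩, h2⟩
  rw [ditherLaw, cond_apply measurableSet_Ioo, hset, Real.volume_Ioo, Real.volume_Ioo,
    ← ENNReal.ofReal_inv_of_pos (by linarith), ← ENNReal.ofReal_mul (inv_nonneg.2 (by linarith))]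
  congr 1
  field_simp
  ring

theorem lintegral_ditherLaw_ite (hΔ : 0 < Δ) {t : ℝ} (ht : 0 ≤ t) (ht' : t ≤ 1) (A B : ℝ≥0∞) :
    ∫⁻ u, (if u / Δ + 1 / 2 < t then A else B) ∂ditherLaw Δ =
      ENNReal.ofReal t * A + ENNReal.ofReal (1 - t) * B := by
  have := isProbabilityMeasure_ditherLaw hΔ
  have hm : MeasurableSet {u : ℝ | u / Δ + 1 / 2 < t} :=
    measurableSet_lt (by fun_prop) measurable_const
  have hcompl : ditherLaw Δ {u | u / Δ + 1 / 2 < t}ᶜ = ENNReal.ofReal (1 - t) := by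
    rw [prob_compl_eq_one_sub hm, ditherLaw_lt hΔ ht ht', ENNReal.ofReal_sub _ ht,
      ENNReal.ofReal_one]
  rw [← lintegral_add_compl _ hm, setLIntegral_congr_fun (g := fun _ => A) hm,
    setLIntegral_congr_fun (g := fun _ => B) hm.compl, setLIntegral_const, setLIntegral_const,
    hcompl, ditherLaw_lt hΔ ht ht', mul_comm, mul_comm B]
  · intro u hu
    exact if_neg hu
  · intro u hu
    exact if_pos hu

/-- The update map of the chain of slot counts at event `n`. -/
def slotMap (L : ℕ) (Δ α : ℝ) (e : ZMod N) (n : ℕ) (u : ℝ) (X : ZMod N → ℤ) : ZMod N → ℤ :=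
  slotStep L Δ α (activeIndex e n) u X

/-- The interaction at event `n` is a compression. -/
def compressAt (e : ZMod N) (n : ℕ) (X Y : ZMod N → ℤ) : Prop := Compresses (activeIndex e n) X Y

omit [NeZero N] in
theorem measurable_slotMap (L : ℕ) (Δ α : ℝ) (e : ZMod N) (n : ℕ) (X : ZMod N → ℤ) :
    Measurable fun u => slotMap L Δ α e n u X := by
  have hround : Measurable (round : ℝ → ℤ) := by
    have : (round : ℝ → ℤ) = fun x => ⌊x + 1 / 2⌋ := funext round_eq
    rw [this]
    exact Int.measurable_floor.comp (by fun_prop)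
  have hm : Measurable fun u : ℝ => max 0 (min ((L : ℤ) - 1) (round (((1 + α) / 2 *
      (X (activeIndex e n) * Δ) + (1 - α) / 2 * (X (activeIndex e n + 1) * Δ) + u) / Δ))) :=
    measurable_const.max (measurable_const.min (hround.comp (by fun_prop)))
  refine measurable_pi_lambda _ fun j => ?_
  unfold slotMap slotStep
  by_cases hj : j = activeIndex e n + 1
  · subst hj
    simp only [Function.update_self]
    exact measurable_const.sub hm
  · simp only [Function.update_of_ne hj]
    by_cases hj' : j = activeIndex e n
    · subst hj'
      simpa only [Function.update_self] using hm
    · simp only [Function.update_of_ne hj']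
      exact measurable_const

/-! ### One-step estimates by the difference across the active edge -/

section Transition

variable (hN : 2 ≤ N) (hΔ : 0 < Δ) (hα : 0 < α) (hα' : α < 1) {X : ZMod N → ℤ}
  (hX : IsSlotState L X) (e : ZMod N) (n : ℕ) (Φ : (ZMod N → ℤ) → ℝ≥0∞)

include hN hΔ hα hα' hX

theorem lintegral_kill_le_of_eq (h : X (activeIndex e n) = X (activeIndex e n + 1)) :
    ∫⁻ u, kill (compressAt e) n X Φ (slotMap L Δ α e n u X) ∂ditherLaw Δ ≤ Φ X := by
  have := isProbabilityMeasure_ditherLaw hΔ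
  refine (lintegral_mono_ae (g := fun _ => Φ X) ?_).trans (by simp)
  filter_upwards [ae_ditherLaw Δ] with u hu
  obtain ⟨m, -, hlo, hhi, hs⟩ := slotStep_eq hN hΔ hα hα' hX (activeIndex e n) hu
  have hm : m = X (activeIndex e n) := by omega
  rw [slotMap, hs, hm, update_pair_self]
  unfold kill
  split_ifs <;> simp

/-- No integer lies strictly between the two values, so they stay or are exchanged, and the
threshold for `w` gives exchange probability `(1-α)/2`. -/
theorem lintegral_kill_le_of_abs_eq_one
    (h : |X (activeIndex e n) - X (activeIndex e n + 1)| = 1) :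
    ∫⁻ u, kill (compressAt e) n X Φ (slotMap L Δ α e n u X) ∂ditherLaw Δ ≤
      ENNReal.ofReal ((1 - α) / 2) *
        Φ (X ∘ Equiv.swap (activeIndex e n) (activeIndex e n + 1)) +
      ENNReal.ofReal (1 - (1 - α) / 2) * Φ X := by
  have hkill : ∀ Y, kill (compressAt e) n X Φ Y ≤ Φ Y := fun Y => by
    unfold kill
    split_ifs <;> simp
  rcases (abs_eq zero_le_one).1 h with h | h
  · have hint := lintegral_ditherLaw_ite hΔ (t := (1 - α) / 2) (by linarith) (by linarith)
      (Φ (X ∘ Equiv.swap (activeIndex e n) (activeIndex e n + 1))) (Φ X)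
    refine le_trans (lintegral_mono_ae ?_) hint.le
    filter_upwards [ae_ditherLaw Δ] with u hu
    refine (hkill _).trans ?_
    obtain ⟨m, hm, hlo, hhi, hs⟩ := slotStep_eq hN hΔ hα hα' hX (activeIndex e n) hu
    have hb : X (activeIndex e n + 1) = X (activeIndex e n) - 1 := by omega
    have hbR : (X (activeIndex e n + 1) : ℝ) = X (activeIndex e n) - 1 := by
      rw [hb]; push_cast; rfl
    have hmcases : m = X (activeIndex e n) ∨ m = X (activeIndex e n + 1) := by omega
    have hfl := Int.floor_le ((X (activeIndex e n) : ℝ) + (1 - α) / 2 *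
      (X (activeIndex e n + 1) - X (activeIndex e n)) + (u / Δ + 1 / 2))
    have hfl' := Int.lt_floor_add_one ((X (activeIndex e n) : ℝ) + (1 - α) / 2 *
      (X (activeIndex e n + 1) - X (activeIndex e n)) + (u / Δ + 1 / 2))
    rw [← hm] at hfl hfl'
    rw [slotMap, hs]
    rcases hmcases with hm' | hm'
    · rw [hm', hbR] at hfl
      rw [if_neg (by linarith), hm', update_pair_self]
    · rw [hm', hbR] at hfl'
      rw [if_pos (by linarith), hm', update_pair_swap]
  -- With the larger value on the right, small `w` means no exchange, so the threshold is the
  -- complementary one.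
  · have hint := lintegral_ditherLaw_ite hΔ (t := 1 - (1 - α) / 2) (by linarith) (by linarith)
      (Φ X) (Φ (X ∘ Equiv.swap (activeIndex e n) (activeIndex e n + 1)))
    rw [sub_sub_cancel, add_comm (ENNReal.ofReal _ * _)] at hint
    refine le_trans (lintegral_mono_ae ?_) hint.le
    filter_upwards [ae_ditherLaw Δ] with u hu
    refine (hkill _).trans ?_
    obtain ⟨m, hm, hlo, hhi, hs⟩ := slotStep_eq hN hΔ hα hα' hX (activeIndex e n) hu
    have hb : X (activeIndex e n + 1) = X (activeIndex e n) + 1 := by omega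
    have hbR : (X (activeIndex e n + 1) : ℝ) = X (activeIndex e n) + 1 := by
      rw [hb]; push_cast; rfl
    have hmcases : m = X (activeIndex e n) ∨ m = X (activeIndex e n + 1) := by omega
    have hfl := Int.floor_le ((X (activeIndex e n) : ℝ) + (1 - α) / 2 *
      (X (activeIndex e n + 1) - X (activeIndex e n)) + (u / Δ + 1 / 2))
    have hfl' := Int.lt_floor_add_one ((X (activeIndex e n) : ℝ) + (1 - α) / 2 *
      (X (activeIndex e n + 1) - X (activeIndex e n)) + (u / Δ + 1 / 2))
    rw [← hm] at hfl hfl'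
    rw [slotMap, hs]
    rcases hmcases with hm' | hm'
    · rw [hm', hbR] at hfl'
      rw [if_pos (by linarith), hm', update_pair_self]
    · rw [hm', hbR] at hfl
      rw [if_neg (by linarith), hm', update_pair_swap]

/-- Avoiding compression forces `m` to stay at `X i`. The weighted mean is at distance at least `2 *
(1-α)/2 = 1-α` from `X i`, and `w` can make up for this only with probability at most `α`. -/
theorem lintegral_kill_le_of_two_le
    (h : 2 ≤ |X (activeIndex e n) - X (activeIndex e n + 1)|) :
    ∫⁻ u, kill (compressAt e) n X Φ (slotMap L Δ α e n u X) ∂ditherLaw Δ ≤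
      ENNReal.ofReal α * Φ X := by
  have hkey : ∀ u ∈ Set.Ioo (-(Δ / 2)) (Δ / 2),
      ¬ compressAt e n X (slotMap L Δ α e n u X) → slotMap L Δ α e n u X = X ∧
        X (activeIndex e n) = ⌊(X (activeIndex e n) : ℝ) + (1 - α) / 2 *
          (X (activeIndex e n + 1) - X (activeIndex e n)) + (u / Δ + 1 / 2)⌋ := by
    intro u hu hc
    obtain ⟨m, hm, hlo, hhi, hs⟩ := slotStep_eq hN hΔ hα hα' hX (activeIndex e n) hu
    have hw0 : 0 < u / Δ + 1 / 2 := by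
      have : -(1 / 2) < u / Δ := by rw [lt_div_iff₀ hΔ]; linarith [hu.1]
      linarith
    have hw1 : u / Δ + 1 / 2 < 1 := by
      have : u / Δ < 1 / 2 := by rw [div_lt_iff₀ hΔ]; linarith [hu.2]
      linarith
    have hfl := Int.floor_le ((X (activeIndex e n) : ℝ) + (1 - α) / 2 *
      (X (activeIndex e n + 1) - X (activeIndex e n)) + (u / Δ + 1 / 2))
    have hfl' := Int.lt_floor_add_one ((X (activeIndex e n) : ℝ) + (1 - α) / 2 *
      (X (activeIndex e n + 1) - X (activeIndex e n)) + (u / Δ + 1 / 2))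
    rw [← hm] at hfl hfl' ⊢
    unfold compressAt Compresses at hc
    rw [slotMap, hs] at hc ⊢
    have hne := ne_add_one hN (activeIndex e n)
    rw [Function.update_self, Function.update_of_ne hne, Function.update_self] at hc
    -- A full exchange is impossible: the mean is at distance more than one from the right value,
    -- since its weight there is below one half and the gap is at least two.
    have hmb : m ≠ X (activeIndex e n + 1) := by
      rintro rfl
      rcases le_abs.1 h with h | h
      · have h' : (2 : ℝ) ≤ X (activeIndex e n) - X (activeIndex e n + 1) := by exact_mod_cast h
        nlinarith
      · have h' : (2 : ℝ) ≤ -(X (activeIndex e n) - X (activeIndex e n + 1)) := by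
          exact_mod_cast h
        nlinarith
    have hma : m = X (activeIndex e n) := by
      rcases abs_cases (m - (X (activeIndex e n) + X (activeIndex e n + 1) - m)) with h | h <;>
        rcases abs_cases (X (activeIndex e n) - X (activeIndex e n + 1)) with h' | h' <;> omega
    rw [hma, update_pair_self]
    exact ⟨rfl, rfl⟩
  rcases le_abs.1 h with h | h
  · have h' : (2 : ℝ) ≤ X (activeIndex e n) - X (activeIndex e n + 1) := by exact_mod_cast h
    have hint := lintegral_ditherLaw_ite hΔ (t := 1 - α) (by linarith) (by linarith) 0 (Φ X)
    rw [mul_zero, zero_add, sub_sub_cancel] at hint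
    refine le_trans (lintegral_mono_ae ?_) hint.le
    filter_upwards [ae_ditherLaw Δ] with u hu
    unfold kill
    split_ifs with hc hw hw
    · exact le_rfl
    · exact zero_le
    · exfalso
      have := (Int.le_floor.1 (hkey u hu hc).2.le)
      nlinarith
    · rw [(hkey u hu hc).1]
  · have h' : (2 : ℝ) ≤ -(X (activeIndex e n) - X (activeIndex e n + 1)) := by exact_mod_cast h
    have hint := lintegral_ditherLaw_ite hΔ (t := α) (by linarith) (by linarith) (Φ X) 0
    rw [mul_zero, add_zero] at hint
    refine le_trans (lintegral_mono_ae ?_) hint.le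
    filter_upwards [ae_ditherLaw Δ] with u hu
    unfold kill
    split_ifs with hc hw hw
    · exact zero_le
    · exact le_rfl
    · rw [(hkey u hu hc).1]
    · exfalso
      have h1 := (hkey u hu hc).2
      have h2 := Int.lt_floor_add_one ((X (activeIndex e n) : ℝ) + (1 - α) / 2 *
        (X (activeIndex e n + 1) - X (activeIndex e n)) + (u / Δ + 1 / 2))
      rw [← h1] at h2
      nlinarith

end Transition

end RingChain

/-! ### The potential, rotation symmetry and the absorption bound -/

section Absorption

variable {N : ℕ} [NeZero N] {L : ℕ} {Δ α : ℝ}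

theorem potential_scale (hΔ : 0 < Δ) {X : ZMod N → ℤ} (hX : IsSlotState L X) :
    potential Δ (scale Δ X) = ∑ i, ((X i : ℝ) - L / N) ^ 2 := by
  have hsum : ∑ j, scale Δ X j = L * Δ := ((scale_mem_states hΔ X).2 hX).2.2
  rw [potential, hsum, div_eq_iff (by positivity), Finset.sum_mul]
  refine Finset.sum_congr rfl fun i _ => ?_
  rw [scale]
  ring

theorem potential_scale_eq (hΔ : 0 < Δ) {X : ZMod N → ℤ} (hX : IsSlotState L X) :
    potential Δ (scale Δ X) = ((∑ i, X i ^ 2 : ℤ) : ℝ) - (L : ℝ) ^ 2 / N := by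
  have hN : (N : ℝ) ≠ 0 := Nat.cast_ne_zero.2 (NeZero.ne N)
  have hsum : ∑ i, (X i : ℝ) = L := by exact_mod_cast hX.2
  rw [potential_scale hΔ hX]
  simp only [sub_sq, Finset.sum_add_distrib, Finset.sum_sub_distrib, ← Finset.sum_mul,
    ← Finset.mul_sum, hsum, Finset.sum_const, Finset.card_univ, ZMod.card, nsmul_eq_mul]
  push_cast
  field_simp
  ring

/-- The excesses `X i - 1` are nonnegative with sum `L - N`, so their squares sum to at most
`(L-N)²`. Subtracting the mean gives `(L-N)²(1 - 1/N)`, and `1 - 1/N ≤ N/4` is `(N-2)² ≥ 0`. -/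
theorem potential_scale_le (hN : 2 ≤ N) (hΔ : 0 < Δ) {X : ZMod N → ℤ} (hX : IsSlotState L X) :
    potential Δ (scale Δ X) ≤ ((L : ℝ) - N) ^ 2 * N / 4 := by
  have hN' : (2 : ℝ) ≤ N := by exact_mod_cast hN
  have hN0 : (N : ℝ) ≠ 0 := by positivity
  have hsum : ∑ i, (X i - 1) = (L : ℤ) - N := by
    rw [Finset.sum_sub_distrib, hX.2]
    simp
  have hsq : ∑ i, (X i - 1) ^ 2 ≤ ((L : ℤ) - N) ^ 2 := by
    rw [sq ((L : ℤ) - N)]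
    nth_rewrite 1 [← hsum]
    rw [Finset.sum_mul]
    refine Finset.sum_le_sum fun i _ => ?_
    have hi := hX.1 i
    have hle : X i - 1 ≤ (L : ℤ) - N := by
      rw [← hsum]
      exact Finset.single_le_sum (f := fun i => X i - 1) (fun j _ => by linarith [hX.1 j])
        (Finset.mem_univ i)
    nlinarith
  have hexp : ∑ i, (X i - 1) ^ 2 = ∑ i, X i ^ 2 - 2 * L + N := by
    rw [← hX.2, Finset.mul_sum, ← Finset.sum_sub_distrib]
    have : (N : ℤ) = ∑ i : ZMod N, 1 := by simp
    rw [this, ← Finset.sum_add_distrib]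
    exact Finset.sum_congr rfl fun i _ => by ring
  have hsq' : ((∑ i, X i ^ 2 : ℤ) : ℝ) ≤ ((L : ℝ) - N) ^ 2 + 2 * L - N := by
    have : ∑ i, X i ^ 2 ≤ ((L : ℤ) - N) ^ 2 + 2 * L - N := by linarith
    exact_mod_cast this
  rw [potential_scale_eq hΔ hX]
  have hdiv : (L : ℝ) ^ 2 / N = ((L : ℝ) - N) ^ 2 / N + 2 * L - N := by
    field_simp
    ring
  have hinv : 1 - 1 / (N : ℝ) ≤ N / 4 := by
    rw [sub_le_iff_le_add, ← sub_le_iff_le_add', le_div_iff₀ (by linarith)]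
    nlinarith [sq_nonneg ((N : ℝ) - 2)]
  have := mul_le_mul_of_nonneg_left hinv (sq_nonneg ((L : ℝ) - N))
  have h2 : ((L : ℝ) - N) ^ 2 / N = ((L : ℝ) - N) ^ 2 * (1 / N) := by ring
  rw [hdiv, h2]
  linarith

theorem exists_two_le_of_not_tdm {X : ZMod N → ℤ} (hX : IsSlotState L X) (h : ¬ IsSlotTdm L X) :
    ∃ i j, 2 ≤ |X i - X j| := by
  by_contra! hcon
  exact h ⟨hX, fun i j => by have := hcon i j; omega⟩

/-- Two deviations `s, t` from the mean with `|s - t| ≥ 2` satisfy `s² + t² ≥ (s-t)²/2 ≥ 2`. -/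
theorem two_le_potential_scale (hΔ : 0 < Δ) {X : ZMod N → ℤ} (hX : IsSlotState L X)
    (h : ¬ IsSlotTdm L X) : 2 ≤ potential Δ (scale Δ X) := by
  obtain ⟨i, j, hij⟩ := exists_two_le_of_not_tdm hX h
  have hne : i ≠ j := by
    rintro rfl
    simp at hij
  rw [potential_scale hΔ hX]
  have hsub := Finset.sum_le_sum_of_subset_of_nonneg (Finset.subset_univ {i, j})
    fun k _ _ => sq_nonneg ((X k : ℝ) - L / N)
  rw [Finset.sum_pair hne] at hsub
  have hij' : (2 : ℝ) ≤ |(X i : ℝ) - X j| := by exact_mod_cast hij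
  have h4 : (4 : ℝ) ≤ ((X i : ℝ) - X j) ^ 2 := by
    rw [← sq_abs]
    nlinarith
  nlinarith [sq_nonneg (((X i : ℝ) - L / N) + ((X j : ℝ) - L / N))]

theorem step_potential (hN : 2 ≤ N) (hΔ : 0 < Δ) (hα : 0 < α) (hα' : α < 1) {q : ZMod N → ℝ}
    (hq : q ∈ states N L Δ) (i : ZMod N) {v : ℝ} (hv : v ∈ Set.Ioo (-(Δ / 2)) (Δ / 2)) :
    (IsCompression i q (step L Δ α i v q) →
      potential Δ (step L Δ α i v q) ≤ potential Δ q - 2) ∧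
    (¬ IsCompression i q (step L Δ α i v q) →
      potential Δ (step L Δ α i v q) = potential Δ q) ∧
    (|q i - q (i + 1)| ≤ Δ → ¬ IsCompression i q (step L Δ α i v q)) := by
  obtain ⟨X, hX, rfl⟩ := exists_scale_eq hΔ hq
  obtain ⟨hX', hc, hnc⟩ := slotStep_cases hN hΔ hα hα' hX i hv
  rw [step_scale, isCompression_scale hΔ, potential_scale_eq hΔ hX, potential_scale_eq hΔ hX',
    abs_scale_sub_le hΔ]
  refine ⟨fun h => ?_, fun h => ?_, fun h hcomp => ?_⟩
  · have : ((∑ j, slotStep L Δ α i v X j ^ 2 : ℤ) : ℝ) ≤ ((∑ j, X j ^ 2 - 2 : ℤ) : ℝ) := by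
      exact_mod_cast (hc h).2
    rw [Int.cast_sub] at this
    norm_num at this ⊢
    linarith
  · rw [hnc h]
  · have := (hc hcomp).1
    omega

omit [NeZero N] in
theorem run_scale {Ω : Type*} (e : ZMod N) (v : ℕ → Ω → ℝ) (n : ℕ) (X : ZMod N → ℤ) (k : ℕ) (ω : Ω) :
    run L Δ α e v n (scale Δ X) k ω =
      scale Δ (traj (slotMap L Δ α e) (fun m => v m ω) n X k) := by
  induction k with
  | zero => rfl
  | succ k ih => rw [run, ih, step_scale, traj, slotMap]

omit [NeZero N] in
theorem compressionTime_scale {Ω : Type*} (hΔ : 0 < Δ) (e : ZMod N) (v : ℕ → Ω → ℝ) (n : ℕ)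
    (X : ZMod N → ℤ) (ω : Ω) :
    compressionTime L Δ α e v n (scale Δ X) ω =
      stopTime (slotMap L Δ α e) (compressAt e) (fun m => v m ω) n X := by
  simp only [compressionTime, stopTime, run_scale, isCompression_scale hΔ, compressAt]

/-- The interaction reaches a TDM state. -/
def reachesTdm (L : ℕ) (_ : ℕ) (_ Y : ZMod N → ℤ) : Prop := IsSlotTdm L Y

/-- Only an inequality: `stopTime` tests the state after each transition and so is at least one,
even when the start is already TDM. -/
theorem absorptionTime_scale_le {Ω : Type*} (hΔ : 0 < Δ) (e : ZMod N) (v : ℕ → Ω → ℝ) (n : ℕ)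
    (X : ZMod N → ℤ) (ω : Ω) :
    absorptionTime L Δ α e v n (scale Δ X) ω ≤
      stopTime (slotMap L Δ α e) (reachesTdm L) (fun m => v m ω) n X := by
  refine le_iInf₂ fun k hk => iInf₂_le (k + 1) ?_
  rw [run_scale, scale_mem_tdmStates hΔ]
  exact hk

theorem absorptionTime_scale_of_tdm {Ω : Type*} (hΔ : 0 < Δ) (e : ZMod N) (v : ℕ → Ω → ℝ) (n : ℕ)
    {X : ZMod N → ℤ} (hX : IsSlotTdm L X) (ω : Ω) :
    absorptionTime L Δ α e v n (scale Δ X) ω = 0 := by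
  refine le_antisymm ((iInf₂_le 0 ?_).trans_eq Nat.cast_zero) zero_le
  rw [run_scale, scale_mem_tdmStates hΔ]
  exact hX

theorem IsDither.map_eq {Ω : Type*} [MeasurableSpace Ω] {P : Measure Ω} {v : ℕ → Ω → ℝ}
    (hv : IsDither P Δ v) (n : ℕ) : P.map (v n) = ditherLaw Δ := hv.uniform n

theorem lintegral_compressionTime {Ω : Type*} [MeasurableSpace Ω] {P : Measure Ω}
    [IsProbabilityMeasure P] {v : ℕ → Ω → ℝ} (hv : IsDither P Δ v) (hΔ : 0 < Δ) (e : ZMod N) (n : ℕ)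
    (X : ZMod N → ℤ) :
    ∫⁻ ω, compressionTime L Δ α e v n (scale Δ X) ω ∂P =
      expTime (slotMap L Δ α e) (compressAt e) (ditherLaw Δ) n X := by
  simp only [compressionTime_scale hΔ]
  exact lintegral_stopTime (measurable_slotMap L Δ α e) _ hv.measurable hv.indep hv.map_eq n X

theorem maxCompression_eq {Ω : Type*} [MeasurableSpace Ω] {P : Measure Ω}
    [IsProbabilityMeasure P] {v : ℕ → Ω → ℝ} (hv : IsDither P Δ v) (hΔ : 0 < Δ) (e : ZMod N) (n : ℕ) :
    maxCompression P L Δ α e v n =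
      ⨆ (X : ZMod N → ℤ) (_ : IsSlotState L X ∧ ¬ IsSlotTdm L X),
        expTime (slotMap L Δ α e) (compressAt e) (ditherLaw Δ) n X := by
  refine le_antisymm (iSup₂_le fun q hq => ?_) (iSup₂_le fun X hX => ?_)
  · obtain ⟨X, hX, rfl⟩ := exists_scale_eq hΔ hq.1
    rw [lintegral_compressionTime hv hΔ]
    exact le_iSup₂ (f := fun (X : ZMod N → ℤ) (_ : IsSlotState L X ∧ ¬ IsSlotTdm L X) =>
      expTime (slotMap L Δ α e) (compressAt e) (ditherLaw Δ) n X) X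
      ⟨hX, mt (scale_mem_tdmStates hΔ X).2 hq.2⟩
  · rw [← lintegral_compressionTime hv hΔ]
    exact le_iSup₂ (f := fun (q : ZMod N → ℝ) (_ : q ∈ states N L Δ \ tdmStates N L Δ) =>
      ∫⁻ ω, compressionTime L Δ α e v n q ω ∂P) (scale Δ X)
      ⟨(scale_mem_states hΔ X).2 hX.1, mt (scale_mem_tdmStates hΔ X).1 hX.2⟩

/-- The state seen from the next vertex. -/
def rotate (X : ZMod N → ℤ) : ZMod N → ℤ := fun j => X (j + 1)

omit [NeZero N] in
theorem activeIndex_succ (e : ZMod N) (n : ℕ) : activeIndex e (n + 1) + 1 = activeIndex e n := by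
  simp only [activeIndex]
  push_cast
  ring

-- The active edge moves down by one per event, so shifting the indices by one compensates for a
-- shift of the clock.
omit [NeZero N] in
theorem slotMap_rotate (e : ZMod N) (n : ℕ) (u : ℝ) (X : ZMod N → ℤ) :
    slotMap L Δ α e (n + 1) u (rotate X) = rotate (slotMap L Δ α e n u X) := by
  funext j
  have h := activeIndex_succ e n
  simp only [slotMap, slotStep, rotate, h, Function.update_apply]
  have h1 : j = activeIndex e n ↔ j + 1 = activeIndex e n + 1 := by simp
  have h2 : j = activeIndex e (n + 1) ↔ j + 1 = activeIndex e n := by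
    rw [← h]
    simp
  simp only [h1, h2]

omit [NeZero N] in
theorem compressAt_rotate (e : ZMod N) (n : ℕ) (X Y : ZMod N → ℤ) :
    compressAt e (n + 1) (rotate X) (rotate Y) ↔ compressAt e n X Y := by
  simp only [compressAt, Compresses, rotate, activeIndex_succ]

theorem sum_rotate (X : ZMod N → ℤ) : ∑ j, rotate X j = ∑ j, X j :=
  Fintype.sum_equiv (Equiv.addRight 1) _ _ fun _ => rfl

theorem isSlotState_rotate (X : ZMod N → ℤ) : IsSlotState L (rotate X) ↔ IsSlotState L X := by
  unfold IsSlotState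
  rw [sum_rotate]
  refine and_congr ⟨fun h i => ?_, fun h i => h (i + 1)⟩ Iff.rfl
  simpa [rotate] using h (i - 1)

theorem isSlotTdm_rotate (X : ZMod N → ℤ) : IsSlotTdm L (rotate X) ↔ IsSlotTdm L X := by
  unfold IsSlotTdm
  rw [isSlotState_rotate]
  refine and_congr Iff.rfl ⟨fun h i j => ?_, fun h i j => h (i + 1) (j + 1)⟩
  simpa [rotate] using h (i - 1) (j - 1)

omit [NeZero N] in
theorem expTime_compressAt_rotate (e : ZMod N) (n : ℕ) (X : ZMod N → ℤ) :
    expTime (slotMap L Δ α e) (compressAt e) (ditherLaw Δ) (n + 1) (rotate X) =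
      expTime (slotMap L Δ α e) (compressAt e) (ditherLaw Δ) n X :=
  expTime_shift _ _ _ rotate (slotMap_rotate e) (compressAt_rotate e) n X

/-- By rotation symmetry, the starting event does not matter. -/
theorem maxCompression_eq_zero {Ω : Type*} [MeasurableSpace Ω] {P : Measure Ω}
    [IsProbabilityMeasure P] {v : ℕ → Ω → ℝ} (hv : IsDither P Δ v) (hΔ : 0 < Δ) (e : ZMod N) (n : ℕ) :
    maxCompression P L Δ α e v n = maxCompression P L Δ α e v 0 := by
  induction n with
  | zero => rfl
  | succ n ih =>
    rw [← ih, maxCompression_eq hv hΔ, maxCompression_eq hv hΔ]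
    refine le_antisymm (iSup₂_le fun X hX => ?_) (iSup₂_le fun X hX => ?_)
    · have hrot : X = rotate fun j => X (j - 1) := by
        funext j
        simp [rotate]
      rw [hrot, expTime_compressAt_rotate]
      rw [hrot, isSlotState_rotate, isSlotTdm_rotate] at hX
      exact le_iSup₂ (f := fun (X : ZMod N → ℤ) (_ : IsSlotState L X ∧ ¬ IsSlotTdm L X) =>
        expTime (slotMap L Δ α e) (compressAt e) (ditherLaw Δ) n X) _ hX
    · rw [← expTime_compressAt_rotate]
      rw [← isSlotState_rotate, ← isSlotTdm_rotate] at hX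
      exact le_iSup₂ (f := fun (X : ZMod N → ℤ) (_ : IsSlotState L X ∧ ¬ IsSlotTdm L X) =>
        expTime (slotMap L Δ α e) (compressAt e) (ditherLaw Δ) (n + 1) X) _ hX

/-- The right-hand side serves as the Lyapunov function: first-step analysis of the compression time
supplies the unit decrease, and each drop of `V` by two releases one `T`. -/
theorem expTime_reachesTdm_le (hN : 2 ≤ N) (hΔ : 0 < Δ) (hα : 0 < α) (hα' : α < 1) (e : ZMod N)
    (T : ℝ≥0∞) (hT : ∀ n (X : ZMod N → ℤ), IsSlotState L X → ¬ IsSlotTdm L X →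
      expTime (slotMap L Δ α e) (compressAt e) (ditherLaw Δ) n X ≤ T)
    (n : ℕ) (X : ZMod N → ℤ) (hX : IsSlotState L X ∧ ¬ IsSlotTdm L X) :
    expTime (slotMap L Δ α e) (reachesTdm L) (ditherLaw Δ) n X ≤
      T * ENNReal.ofReal ((potential Δ (scale Δ X) - 2) / 2) +
        expTime (slotMap L Δ α e) (compressAt e) (ditherLaw Δ) n X := by
  have := isProbabilityMeasure_ditherLaw hΔ
  refine expTime_le (measurable_slotMap L Δ α e) (reachesTdm L) (ditherLaw Δ)
    (fun X => IsSlotState L X ∧ ¬ IsSlotTdm L X)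
    (fun n X => T * ENNReal.ofReal ((potential Δ (scale Δ X) - 2) / 2) +
        expTime (slotMap L Δ α e) (compressAt e) (ditherLaw Δ) n X) ?_ ?_ n X hX
  · intro n X hX
    filter_upwards [ae_ditherLaw Δ] with u hu hs
    exact ⟨(slotStep_cases hN hΔ hα hα' hX.1 _ hu).1, hs⟩
  · intro n X hX
    rw [expTime_eq (measurable_slotMap L Δ α e) (compressAt e), add_left_comm]
    refine add_le_add le_rfl ?_
    have hconst : T * ENNReal.ofReal ((potential Δ (scale Δ X) - 2) / 2) =
        ∫⁻ _, T * ENNReal.ofReal ((potential Δ (scale Δ X) - 2) / 2) ∂ditherLaw Δ := by simp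
    rw [hconst, ← lintegral_add_left measurable_const]
    refine lintegral_mono_ae ?_
    filter_upwards [ae_ditherLaw Δ] with u hu
    have hX' := (slotStep_cases hN hΔ hα hα' hX.1 (activeIndex e n) hu).1
    obtain ⟨hc, hnc, -⟩ := step_potential hN hΔ hα hα' ((scale_mem_states hΔ X).2 hX.1)
      (activeIndex e n) hu
    rw [step_scale, isCompression_scale hΔ] at hc hnc
    by_cases htdm : reachesTdm L n X (slotMap L Δ α e n u X)
    · rw [kill, if_pos htdm]
      exact zero_le
    rw [kill, if_neg htdm]
    by_cases hcomp : compressAt e n X (slotMap L Δ α e n u X)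
    · rw [kill, if_pos hcomp, add_zero]
      refine (add_le_add le_rfl (hT (n + 1) _ hX' htdm)).trans ?_
      have h2 := two_le_potential_scale hΔ hX' htdm
      have hdrop := hc hcomp
      calc _ = T * (ENNReal.ofReal ((potential Δ (scale Δ (slotMap L Δ α e n u X)) - 2) / 2) +
              ENNReal.ofReal 1) := by rw [ENNReal.ofReal_one, mul_add, mul_one]
        _ ≤ _ := by
          rw [← ENNReal.ofReal_add (by rw [slotMap]; linarith) zero_le_one]
          refine mul_le_mul_right (ENNReal.ofReal_le_ofReal ?_) _
          rw [slotMap]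
          linarith
    · rw [kill, if_neg hcomp]
      have heq : potential Δ (scale Δ (slotMap L Δ α e n u X)) = potential Δ (scale Δ X) :=
        hnc hcomp
      rw [heq]

/-- Every compression lowers the potential by two, so the absorption time is bounded by the time
per compression. -/
theorem maxAbsorption_le {Ω : Type*} [MeasurableSpace Ω] {P : Measure Ω}
    [IsProbabilityMeasure P] {v : ℕ → Ω → ℝ} (hv : IsDither P Δ v) (hN : 2 ≤ N) (hΔ : 0 < Δ)
    (hα : 0 < α) (hα' : α < 1) (e : ZMod N) (n : ℕ) :
    maxAbsorption P L Δ α e v n ≤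
      maxCompression P L Δ α e v n * ENNReal.ofReal (((L : ℝ) - N) ^ 2 * N / 8) := by
  refine iSup₂_le fun q hq => ?_
  obtain ⟨X, hX, rfl⟩ := exists_scale_eq hΔ hq
  by_cases htdm : IsSlotTdm L X
  · simp [absorptionTime_scale_of_tdm hΔ e v n htdm]
  have hT : ∀ m (Y : ZMod N → ℤ), IsSlotState L Y → ¬ IsSlotTdm L Y →
      expTime (slotMap L Δ α e) (compressAt e) (ditherLaw Δ) m Y ≤
        maxCompression P L Δ α e v n := by
    intro m Y hY hY'
    rw [maxCompression_eq_zero hv hΔ e n, ← maxCompression_eq_zero hv hΔ e m,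
      maxCompression_eq hv hΔ]
    exact le_iSup₂ (f := fun (X : ZMod N → ℤ) (_ : IsSlotState L X ∧ ¬ IsSlotTdm L X) =>
      expTime (slotMap L Δ α e) (compressAt e) (ditherLaw Δ) m X) Y ⟨hY, hY'⟩
  have h2 := two_le_potential_scale hΔ hX htdm
  calc ∫⁻ ω, absorptionTime L Δ α e v n (scale Δ X) ω ∂P
      ≤ ∫⁻ ω, stopTime (slotMap L Δ α e) (reachesTdm L) (fun m => v m ω) n X ∂P :=
        lintegral_mono fun ω => absorptionTime_scale_le hΔ e v n X ω
    _ = expTime (slotMap L Δ α e) (reachesTdm L) (ditherLaw Δ) n X :=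
        lintegral_stopTime (measurable_slotMap L Δ α e) _ hv.measurable hv.indep hv.map_eq n X
    _ ≤ maxCompression P L Δ α e v n * ENNReal.ofReal ((potential Δ (scale Δ X) - 2) / 2) +
        maxCompression P L Δ α e v n :=
        (expTime_reachesTdm_le hN hΔ hα hα' e _ hT n X ⟨hX, htdm⟩).trans
          (add_le_add le_rfl (hT n X hX htdm))
    _ = maxCompression P L Δ α e v n * (ENNReal.ofReal ((potential Δ (scale Δ X) - 2) / 2) +
        ENNReal.ofReal 1) := by rw [ENNReal.ofReal_one, mul_add, mul_one]
    -- The last round adds one to `(V-2)/2`, which gives `V/2`.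
    _ ≤ _ := by
      rw [← ENNReal.ofReal_add (by linarith) zero_le_one]
      refine mul_le_mul_right (ENNReal.ofReal_le_ofReal ?_) _
      linarith [potential_scale_le hN hΔ hX]

end Absorption

/-! ### Drift inequalities for two tokens circulating past the active edge -/

section Lyapunov

/-- The position of a token relative to the active edge, corrected by its expected drift; the
corrected position grows by one per event on average. -/
def driftPos (r : ℝ) (a : ℕ) : ℝ := if a = 1 then 1 - r else a

/-- The number of events until a token at relative position `a` is next at the active edge. -/
def returnTime (N a : ℕ) : ℝ := if a = 0 then 0 else (N : ℝ) - a

/-- A function of the relative positions of two tokens that decreases on average by at least one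
per event. -/
def pairFun (N : ℕ) (r : ℝ) (a b : ℕ) : ℝ :=
  N / r * (|driftPos r b - driftPos r a| * (N - |driftPos r b - driftPos r a|)) + returnTime N a

variable {N : ℕ} {r p : ℝ}

theorem driftPos_of_ne {a : ℕ} (ha : a ≠ 1) : driftPos r a = a := if_neg ha

theorem driftPos_one : driftPos r 1 = 1 - r := if_pos rfl

theorem returnTime_of_ne {a : ℕ} (ha : a ≠ 0) : returnTime N a = N - a := if_neg ha

theorem returnTime_zero : returnTime N 0 = 0 := if_pos rfl

theorem driftPos_mono (hr : 0 < r) (hr' : r < 1) {a b : ℕ} (h : a < b) :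
    driftPos r a ≤ driftPos r b := by
  have h' : (a : ℝ) + 1 ≤ b := by exact_mod_cast h
  unfold driftPos
  split_ifs with h1 h2 h2
  · exact le_rfl
  · rw [h1] at h'
    push_cast at h'
    linarith
  · rw [h2] at h'
    push_cast at h'
    linarith
  · linarith

theorem pairFun_of_lt (hr : 0 < r) (hr' : r < 1) {a b : ℕ} (h : a < b) :
    pairFun N r a b = N / r * ((driftPos r b - driftPos r a) *
      (N - (driftPos r b - driftPos r a))) + returnTime N a := by
  rw [pairFun, abs_of_nonneg (sub_nonneg.2 (driftPos_mono hr hr' h))]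

theorem pairFun_of_gt (hr : 0 < r) (hr' : r < 1) {a b : ℕ} (h : b < a) :
    pairFun N r a b = N / r * ((driftPos r a - driftPos r b) *
      (N - (driftPos r a - driftPos r b))) + returnTime N a := by
  rw [pairFun, abs_sub_comm, abs_of_nonneg (sub_nonneg.2 (driftPos_mono hr hr' h))]

theorem driftPos_le (hr : 0 < r) {a : ℕ} : driftPos r a ≤ a := by
  unfold driftPos
  split_ifs with h
  · rw [h]
    push_cast
    linarith
  · exact le_rfl

theorem driftPos_nonneg (hr' : r < 1) {a : ℕ} : 0 ≤ driftPos r a := by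
  unfold driftPos
  split_ifs with h
  · linarith
  · positivity

theorem abs_driftPos_sub_le (hr : 0 < r) (hr' : r < 1) {a b : ℕ} (ha : a < N) (hb : b < N) :
    |driftPos r b - driftPos r a| ≤ N := by
  have ha' : (a : ℝ) ≤ N := by exact_mod_cast ha.le
  have hb' : (b : ℝ) ≤ N := by exact_mod_cast hb.le
  rw [abs_le]
  constructor <;> linarith [driftPos_le hr (a := a), driftPos_le hr (a := b),
    driftPos_nonneg hr' (a := a), driftPos_nonneg hr' (a := b)]

theorem pairFun_nonneg (hr : 0 < r) (hr' : r < 1) {a b : ℕ} (ha : a < N) (hb : b < N) :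
    0 ≤ pairFun N r a b := by
  have h1 := sub_nonneg.2 (abs_driftPos_sub_le hr hr' ha hb)
  have h2 : 0 ≤ returnTime N a := by
    unfold returnTime
    split_ifs
    · exact le_rfl
    · rw [sub_nonneg]
      exact_mod_cast ha.le
  unfold pairFun
  positivity

theorem pairFun_le (hr : 0 < r) {a b : ℕ} :
    pairFun N r a b ≤ N / r * ((N : ℝ) ^ 2 / 4) + N := by
  have h2 : returnTime N a ≤ N := by
    unfold returnTime
    split_ifs
    · positivity
    · rw [sub_le_self_iff]
      positivity
  refine add_le_add (mul_le_mul_of_nonneg_left ?_ (by positivity)) h2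
  nlinarith [sq_nonneg (|driftPos r b - driftPos r a| - N / 2)]

/-- The quadratic part decreases by `N` on average when exactly one token is at the active edge. -/
theorem quadratic_drift {n c D D₁ D₂ ψ ψ₁ ψ₂ : ℝ} (hp : p * (1 + r) = r) (hc : c * r = n)
    (hD : (D₁ = D + 1 ∧ D₂ = D - r) ∨ (D₁ = D - 1 ∧ D₂ = D + r) ∨
      (D₁ = n - (D + 1) ∧ D₂ = n - (D - r)) ∨ (D₁ = n - (D - 1) ∧ D₂ = n - (D + r)))
    (hψ : p * ψ₁ + (1 - p) * ψ₂ + 1 ≤ ψ + n) :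
    p * (c * (D₁ * (n - D₁)) + ψ₁) + (1 - p) * (c * (D₂ * (n - D₂)) + ψ₂) + 1 ≤
      c * (D * (n - D)) + ψ := by
  -- The increments `1` and `-r` (or their negatives) have mean zero since `p(1+r) = r`, and second
  -- moment `p + (1-p)r² = r`. The four cases are the sign of the increment and whether a
  -- wrap-around replaces the gap by `n` minus it.
  have key : p * (D₁ * (n - D₁)) + (1 - p) * (D₂ * (n - D₂)) = D * (n - D) - r := by
    rcases hD with ⟨h1, h2⟩ | ⟨h1, h2⟩ | ⟨h1, h2⟩ | ⟨h1, h2⟩ <;> rw [h1, h2]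
    · linear_combination (n - 2 * D + r - 1) * hp
    · linear_combination (-n + 2 * D + r - 1) * hp
    · linear_combination (n - 2 * D + r - 1) * hp
    · linear_combination (-n + 2 * D + r - 1) * hp
  have h : p * (c * (D₁ * (n - D₁)) + ψ₁) + (1 - p) * (c * (D₂ * (n - D₂)) + ψ₂) =
      c * (D * (n - D)) - n + (p * ψ₁ + (1 - p) * ψ₂) := by
    linear_combination c * key - hc
  linarith

/-- The relative position after one event, for a token that is not moved. -/
def advance (N a : ℕ) : ℕ := if a + 1 = N then 0 else a + 1

/-- Both tokens move rigidly, so the gap is kept or, when one of them wraps around, replaced by its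
complement. The whole decrease comes from `returnTime`. -/
theorem pairFun_advance (hr : 0 < r) (hr' : r < 1) {a b : ℕ} (ha : a < N) (hb : b < N)
    (hab : a ≠ b) (ha2 : 2 ≤ a) (hb2 : 2 ≤ b) :
    pairFun N r (advance N a) (advance N b) + 1 ≤ pairFun N r a b := by
  unfold advance
  split_ifs with h1 h2 h2
  · omega
  · have hN : (N : ℝ) = a + 1 := by exact_mod_cast h1.symm
    rw [pairFun_of_lt hr hr' (by omega), pairFun_of_gt hr hr' (by omega : b < a),
      driftPos_of_ne (by omega), driftPos_of_ne (by omega), driftPos_of_ne (by omega),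
      driftPos_of_ne (by omega), returnTime_zero, returnTime_of_ne (by omega), hN]
    push_cast
    refine le_of_eq ?_
    ring
  · have hN : (N : ℝ) = b + 1 := by exact_mod_cast h2.symm
    rw [pairFun_of_gt hr hr' (by omega), pairFun_of_lt hr hr' (by omega : a < b),
      driftPos_of_ne (by omega), driftPos_of_ne (by omega), driftPos_of_ne (by omega),
      driftPos_of_ne (by omega), returnTime_of_ne (by omega), returnTime_of_ne (by omega), hN]
    push_cast
    refine le_of_eq ?_
    ring
  · rw [pairFun, pairFun,
      driftPos_of_ne (by omega), driftPos_of_ne (by omega), driftPos_of_ne (by omega),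
      driftPos_of_ne (by omega), returnTime_of_ne (by omega), returnTime_of_ne (by omega)]
    push_cast
    rw [add_sub_add_right_eq_sub]
    linarith

/-- The first token starts a new turn: `returnTime` jumps from zero to nearly `N`, and the loss of
`N` in the quadratic part covers this. Here `p` is the exchange probability; an exchanged token goes
from `0` to `1` and then advances to `2`. -/
theorem pairFun_left_zero (hr : 0 < r) (hr' : r < 1) (hp0 : 0 ≤ p) (hp : p * (1 + r) = r) {b : ℕ}
    (hb : b < N) (hb2 : 2 ≤ b) :
    p * pairFun N r 2 (advance N b) + (1 - p) * pairFun N r 1 (advance N b) + 1 ≤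
      pairFun N r 0 b := by
  have hc : (N : ℝ) / r * r = N := div_mul_cancel₀ _ hr.ne'
  unfold advance
  split_ifs with h
  · have hN : (N : ℝ) = b + 1 := by exact_mod_cast h.symm
    rw [pairFun_of_gt hr hr' (by omega : 0 < 2), pairFun_of_gt hr hr' (by omega : 0 < 1),
      pairFun_of_lt hr hr' (by omega : 0 < b), driftPos_one, driftPos_of_ne (by omega : 0 ≠ 1),
      driftPos_of_ne (by omega : 2 ≠ 1), driftPos_of_ne (by omega : b ≠ 1), returnTime_zero,
      returnTime_of_ne (by omega : 2 ≠ 0), returnTime_of_ne (by omega : 1 ≠ 0)]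
    refine quadratic_drift hp hc (Or.inr (Or.inr (Or.inr ⟨?_, ?_⟩))) ?_ <;> push_cast <;>
      linarith
  · rw [pairFun_of_lt hr hr' (by omega : 2 < b + 1), pairFun_of_lt hr hr' (by omega : 1 < b + 1),
      pairFun_of_lt hr hr' (by omega : 0 < b), driftPos_one, driftPos_of_ne (by omega : 0 ≠ 1),
      driftPos_of_ne (by omega : 2 ≠ 1), driftPos_of_ne (by omega : b ≠ 1),
      driftPos_of_ne (by omega : b + 1 ≠ 1), returnTime_zero,
      returnTime_of_ne (by omega : 2 ≠ 0), returnTime_of_ne (by omega : 1 ≠ 0)]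
    refine quadratic_drift hp hc (Or.inr (Or.inl ⟨?_, ?_⟩)) ?_ <;> push_cast <;>
      linarith

theorem pairFun_left_one (hr : 0 < r) (hr' : r < 1) (hp1 : p ≤ 1) (hp : p * (1 + r) = r) {b : ℕ}
    (hb : b < N) (hb2 : 2 ≤ b) :
    p * pairFun N r 1 (advance N b) + (1 - p) * pairFun N r 2 (advance N b) + 1 ≤
      pairFun N r 1 b := by
  have hc : (N : ℝ) / r * r = N := div_mul_cancel₀ _ hr.ne'
  have hN3 : (3 : ℝ) ≤ N := by exact_mod_cast (by omega : 3 ≤ N)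
  unfold advance
  split_ifs with h
  · have hN : (N : ℝ) = b + 1 := by exact_mod_cast h.symm
    rw [pairFun_of_gt hr hr' (by omega : 0 < 2), pairFun_of_gt hr hr' (by omega : 0 < 1),
      pairFun_of_lt hr hr' (by omega : 1 < b), driftPos_one, driftPos_of_ne (by omega : 0 ≠ 1),
      driftPos_of_ne (by omega : 2 ≠ 1), driftPos_of_ne (by omega : b ≠ 1),
      returnTime_of_ne (by omega : 2 ≠ 0), returnTime_of_ne (by omega : 1 ≠ 0)]
    refine quadratic_drift hp hc (Or.inr (Or.inr (Or.inl ⟨?_, ?_⟩))) ?_ <;> push_cast <;>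
      linarith
  · rw [pairFun_of_lt hr hr' (by omega : 2 < b + 1), pairFun_of_lt hr hr' (by omega : 1 < b + 1),
      pairFun_of_lt hr hr' (by omega : 1 < b), driftPos_one,
      driftPos_of_ne (by omega : 2 ≠ 1), driftPos_of_ne (by omega : b ≠ 1),
      driftPos_of_ne (by omega : b + 1 ≠ 1),
      returnTime_of_ne (by omega : 2 ≠ 0), returnTime_of_ne (by omega : 1 ≠ 0)]
    refine quadratic_drift hp hc (Or.inl ⟨?_, ?_⟩) ?_ <;> push_cast <;>
      linarith

theorem pairFun_right_zero (hr : 0 < r) (hr' : r < 1) (hp : p * (1 + r) = r) {a : ℕ}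
    (ha : a < N) (ha2 : 2 ≤ a) :
    p * pairFun N r (advance N a) 2 + (1 - p) * pairFun N r (advance N a) 1 + 1 ≤
      pairFun N r a 0 := by
  have hc : (N : ℝ) / r * r = N := div_mul_cancel₀ _ hr.ne'
  have hN3 : (3 : ℝ) ≤ N := by exact_mod_cast (by omega : 3 ≤ N)
  unfold advance
  split_ifs with h
  · have hN : (N : ℝ) = a + 1 := by exact_mod_cast h.symm
    rw [pairFun_of_lt hr hr' (by omega : 0 < 2), pairFun_of_lt hr hr' (by omega : 0 < 1),
      pairFun_of_gt hr hr' (by omega : 0 < a), driftPos_one, driftPos_of_ne (by omega : 0 ≠ 1),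
      driftPos_of_ne (by omega : 2 ≠ 1), driftPos_of_ne (by omega : a ≠ 1), returnTime_zero,
      returnTime_of_ne (by omega : a ≠ 0)]
    refine quadratic_drift hp hc (Or.inr (Or.inr (Or.inr ⟨?_, ?_⟩))) ?_ <;> push_cast <;>
      linarith
  · rw [pairFun_of_gt hr hr' (by omega : 2 < a + 1), pairFun_of_gt hr hr' (by omega : 1 < a + 1),
      pairFun_of_gt hr hr' (by omega : 0 < a), driftPos_one, driftPos_of_ne (by omega : 0 ≠ 1),
      driftPos_of_ne (by omega : 2 ≠ 1), driftPos_of_ne (by omega : a ≠ 1),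
      driftPos_of_ne (by omega : a + 1 ≠ 1),
      returnTime_of_ne (by omega : a ≠ 0), returnTime_of_ne (by omega : a + 1 ≠ 0)]
    refine quadratic_drift hp hc (Or.inr (Or.inl ⟨?_, ?_⟩)) ?_ <;> push_cast <;>
      linarith

theorem pairFun_right_one (hr : 0 < r) (hr' : r < 1) (hp : p * (1 + r) = r) {a : ℕ}
    (ha : a < N) (ha2 : 2 ≤ a) :
    p * pairFun N r (advance N a) 1 + (1 - p) * pairFun N r (advance N a) 2 + 1 ≤
      pairFun N r a 1 := by
  have hc : (N : ℝ) / r * r = N := div_mul_cancel₀ _ hr.ne'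
  have hN3 : (3 : ℝ) ≤ N := by exact_mod_cast (by omega : 3 ≤ N)
  unfold advance
  split_ifs with h
  · have hN : (N : ℝ) = a + 1 := by exact_mod_cast h.symm
    rw [pairFun_of_lt hr hr' (by omega : 0 < 2), pairFun_of_lt hr hr' (by omega : 0 < 1),
      pairFun_of_gt hr hr' (by omega : 1 < a), driftPos_one, driftPos_of_ne (by omega : 0 ≠ 1),
      driftPos_of_ne (by omega : 2 ≠ 1), driftPos_of_ne (by omega : a ≠ 1), returnTime_zero,
      returnTime_of_ne (by omega : a ≠ 0)]
    refine quadratic_drift hp hc (Or.inr (Or.inr (Or.inl ⟨?_, ?_⟩))) ?_ <;> push_cast <;>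
      linarith
  · rw [pairFun_of_gt hr hr' (by omega : 2 < a + 1), pairFun_of_gt hr hr' (by omega : 1 < a + 1),
      pairFun_of_gt hr hr' (by omega : 1 < a), driftPos_one,
      driftPos_of_ne (by omega : 2 ≠ 1), driftPos_of_ne (by omega : a ≠ 1),
      driftPos_of_ne (by omega : a + 1 ≠ 1),
      returnTime_of_ne (by omega : a ≠ 0), returnTime_of_ne (by omega : a + 1 ≠ 0)]
    refine quadratic_drift hp hc (Or.inl ⟨?_, ?_⟩) ?_ <;> push_cast <;>
      linarith

/-- Since `(1-2p)(1+r) = 1-r`, the surviving mass times the new quadratic part equals the old one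
minus `2n(1-r)`, which covers the return time. The constant satisfies `(1-2p)κ + 1 = κ` and so pays
for the event itself. -/
theorem quadratic_kill {n c κ D D₁ ψ ψ₁ : ℝ} (hr : 0 < r) (hr' : r < 1) (hp : p * (1 + r) = r)
    (hc : c * r = n) (hκ : 2 * p * κ = 1) (hn : 0 ≤ n)
    (hD : D * (n - D) = (1 - r) * (n - (1 - r)))
    (hD₁ : D₁ * (n - D₁) = (1 + r) * (n - (1 + r))) (hψ : 0 ≤ ψ) (hψ₁ : ψ₁ ≤ n) :
    (1 - 2 * p) * (c * (D₁ * (n - D₁)) + ψ₁ + κ) + 1 ≤ c * (D * (n - D)) + ψ + κ := by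
  have hq : (1 - 2 * p) * (1 + r) = 1 - r := by linear_combination (-2) * hp
  have hq0 : 0 ≤ 1 - 2 * p := by
    by_contra! h
    nlinarith
  have hq1 : 1 - 2 * p ≤ 1 - r := by nlinarith
  have h1 : (1 - 2 * p) * (c * (D₁ * (n - D₁)) + ψ₁ + κ) + 1 =
      c * (D * (n - D)) - 2 * n * (1 - r) + (1 - 2 * p) * ψ₁ + κ := by
    rw [hD, hD₁]
    linear_combination c * (n - (1 + r)) * hq - 2 * (1 - r) * hc - hκ
  have h2 : (1 - 2 * p) * ψ₁ ≤ (1 - 2 * p) * n := mul_le_mul_of_nonneg_left hψ₁ hq0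
  have h3 : (1 - 2 * p) * n ≤ (1 - r) * n := mul_le_mul_of_nonneg_right hq1 hn
  have h4 : 0 ≤ n * (1 - r) := mul_nonneg hn (by linarith)
  linarith

/-- The unchanged pair goes from positions `0, 1` to `1, 2`, so the corrected gap goes from `1-r` to
`1+r`. For `N = 2` the position `2` wraps to `0`, where `1-r = N-(1+r)` gives the same product. -/
theorem pairFun_meet (hr : 0 < r) (hr' : r < 1) (hp : p * (1 + r) = r) {κ : ℝ}
    (hκ : 2 * p * κ = 1) (hN : 2 ≤ N) :
    (1 - 2 * p) * (pairFun N r 1 (advance N 1) + κ) + 1 ≤ pairFun N r 0 1 + κ ∧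
    (1 - 2 * p) * (pairFun N r (advance N 1) 1 + κ) + 1 ≤ pairFun N r 1 0 + κ := by
  have hc : (N : ℝ) / r * r = N := div_mul_cancel₀ _ hr.ne'
  have hN2 : (2 : ℝ) ≤ N := by exact_mod_cast hN
  unfold advance
  split_ifs with h
  · have hN' : (N : ℝ) = 2 := by exact_mod_cast h.symm
    rw [pairFun_of_gt hr hr' (by omega : 0 < 1), pairFun_of_lt hr hr' (by omega : 0 < 1),
      driftPos_one, driftPos_of_ne (by omega : 0 ≠ 1), returnTime_zero,
      returnTime_of_ne (by omega : 1 ≠ 0)]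
    constructor <;> refine quadratic_kill hr hr' hp hc hκ (by linarith) ?_ ?_ ?_ ?_ <;>
      push_cast <;> first | linarith | (rw [hN']; ring)
  · rw [pairFun_of_lt hr hr' (by omega : 1 < 1 + 1), pairFun_of_lt hr hr' (by omega : 0 < 1),
      pairFun_of_gt hr hr' (by omega : 1 < 1 + 1), pairFun_of_gt hr hr' (by omega : 0 < 1),
      driftPos_one, driftPos_of_ne (by omega : 0 ≠ 1), driftPos_of_ne (by omega : 1 + 1 ≠ 1),
      returnTime_zero, returnTime_of_ne (by omega : 1 ≠ 0), returnTime_of_ne (by omega : 1 + 1 ≠ 0)]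
    constructor <;> refine quadratic_kill hr hr' hp hc hκ (by linarith) ?_ ?_ ?_ ?_ <;>
      push_cast <;> linarith

end Lyapunov

/-! ### From the two-token function to the expected time to a compression -/

section Tokens

variable {N : ℕ} [NeZero N] {L : ℕ} {Δ α : ℝ}

theorem val_add_one_eq (hN : 2 ≤ N) (a : ZMod N) : (a + 1).val = advance N a.val := by
  have : Fact (1 < N) := ⟨hN⟩
  rw [ZMod.val_add, ZMod.val_one, advance]
  have := ZMod.val_lt a
  split_ifs with h
  · rw [h, Nat.mod_self]
  · exact Nat.mod_eq_of_lt (by omega)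

/-- The bound on the expected time to the next compression, for two tokens at positions `a` and
`b` relative to the active edge whose values differ by at least two. -/
def tokenFun (α : ℝ) (a b : ZMod N) : ℝ :=
  pairFun N ((1 - α) / (1 + α)) a.val b.val + 1 / (1 - α)

theorem ratio_bounds (hα : 0 < α) (hα' : α < 1) :
    0 < (1 - α) / (1 + α) ∧ (1 - α) / (1 + α) < 1 ∧
      (1 - α) / 2 * (1 + (1 - α) / (1 + α)) = (1 - α) / (1 + α) := by
  refine ⟨div_pos (by linarith) (by linarith), ?_, ?_⟩
  · rw [div_lt_one (by linarith)]
    linarith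
  · have : 1 + α ≠ 0 := by linarith
    field_simp
    ring

theorem tokenFun_nonneg (hα : 0 < α) (hα' : α < 1) (a b : ZMod N) : 0 ≤ tokenFun α a b := by
  obtain ⟨hr, hr', -⟩ := ratio_bounds hα hα'
  refine add_nonneg (pairFun_nonneg hr hr' (ZMod.val_lt a) (ZMod.val_lt b)) ?_
  exact div_nonneg zero_le_one (by linarith)

-- The factor `48 = 2 * 24` cancels the `24` in `g`; what remains, `2(1+α)N³/(1-α)`, generously
-- covers the quadratic part, the return time and the constant.
omit [NeZero N] in
theorem tokenFun_le (hN : 2 ≤ N) (hα : 0 < α) (hα' : α < 1) (a b : ZMod N) :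
    tokenFun α a b ≤ 48 * (g α * (N : ℝ) ^ 3) := by
  obtain ⟨hr, -, -⟩ := ratio_bounds hα hα'
  have hN' : (2 : ℝ) ≤ N := by exact_mod_cast hN
  have h1 := pairFun_le (N := N) hr (a := a.val) (b := b.val)
  have hα1 : 0 < 1 - α := by linarith
  have h3 : (8 : ℝ) ≤ (N : ℝ) ^ 3 := by
    calc (8 : ℝ) = 2 ^ 3 := by norm_num
      _ ≤ _ := by gcongr
  have hN3 : (N : ℝ) ≤ (N : ℝ) ^ 3 / 4 := by
    have h4 : (0 : ℝ) ≤ (N : ℝ) ^ 2 - 4 := by nlinarith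
    have h5 : (0 : ℝ) ≤ N * ((N : ℝ) ^ 2 - 4) := by positivity
    linarith
  have heq : (N : ℝ) / ((1 - α) / (1 + α)) * ((N : ℝ) ^ 2 / 4) =
      (1 + α) * ((N : ℝ) ^ 3 / 4) / (1 - α) := by
    field_simp
  have heq' : 48 * (g α * (N : ℝ) ^ 3) = 2 * (1 + α) * (N : ℝ) ^ 3 / (1 - α) := by
    unfold g
    field_simp
    ring
  have hle : (N : ℝ) ≤ (N : ℝ) ^ 3 / 4 / (1 - α) := by
    rw [le_div_iff₀ hα1]
    nlinarith
  calc tokenFun α a b ≤ (1 + α) * ((N : ℝ) ^ 3 / 4) / (1 - α) + (N : ℝ) ^ 3 / 4 / (1 - α) +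
        1 / (1 - α) := by
        unfold tokenFun
        linarith
    _ = ((1 + α) * ((N : ℝ) ^ 3 / 4) + (N : ℝ) ^ 3 / 4 + 1) / (1 - α) := by ring
    _ ≤ 48 * (g α * (N : ℝ) ^ 3) := by
        rw [heq']
        refine div_le_div_of_nonneg_right ?_ hα1.le
        nlinarith

theorem val_swap (hN : 2 ≤ N) (a : ZMod N) :
    (Equiv.swap 0 1 a).val = if a.val = 0 then 1 else if a.val = 1 then 0 else a.val := by
  have : Fact (1 < N) := ⟨hN⟩
  have h0 : a.val = 0 ↔ a = 0 := ZMod.val_eq_zero a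
  have h1 : a.val = 1 ↔ a = 1 := by
    rw [← ZMod.val_one N, (ZMod.val_injective N).eq_iff]
  simp only [h0, h1, Equiv.swap_apply_def]
  split_ifs <;> simp [ZMod.val_one]

theorem tokenFun_drift (hN : 2 ≤ N) (hα : 0 < α) (hα' : α < 1) {a b : ZMod N} (hab : a ≠ b)
    (hne : ¬ (a = 0 ∧ b = 1 ∨ a = 1 ∧ b = 0)) :
    (1 - α) / 2 * tokenFun α (Equiv.swap 0 1 a + 1) (Equiv.swap 0 1 b + 1) +
      (1 - (1 - α) / 2) * tokenFun α (a + 1) (b + 1) + 1 ≤ tokenFun α a b := by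
  have : Fact (1 < N) := ⟨hN⟩
  obtain ⟨hr, hr', hp⟩ := ratio_bounds hα hα'
  have h0 : ∀ c : ZMod N, c = 0 ↔ c.val = 0 := fun c => (ZMod.val_eq_zero c).symm
  have h1 : ∀ c : ZMod N, c = 1 ↔ c.val = 1 := fun c => by
    rw [← ZMod.val_one N, (ZMod.val_injective N).eq_iff]
  have hab' : a.val ≠ b.val := fun h => hab (ZMod.val_injective N h)
  have ha := ZMod.val_lt a
  have hb := ZMod.val_lt b
  rw [h0, h0, h1, h1] at hne
  simp only [tokenFun, val_add_one_eq hN, val_swap hN]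
  generalize a.val = x at *
  generalize b.val = y at *
  suffices h : (1 - α) / 2 * pairFun N ((1 - α) / (1 + α))
      (advance N (if x = 0 then 1 else if x = 1 then 0 else x))
      (advance N (if y = 0 then 1 else if y = 1 then 0 else y)) +
      (1 - (1 - α) / 2) * pairFun N ((1 - α) / (1 + α)) (advance N x) (advance N y) + 1 ≤
      pairFun N ((1 - α) / (1 + α)) x y by linarith
  have hadv0 : advance N 0 = 1 := if_neg (by omega)
  have hadv1 : 3 ≤ N → advance N 1 = 2 := fun h => if_neg (by omega)
  rcases (by omega : x = 0 ∨ x = 1 ∨ 2 ≤ x) with hx | hx | hx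
  · subst hx
    have := pairFun_left_zero hr hr' (by linarith) hp hb (by omega)
    rw [if_pos rfl, if_neg (by omega), if_neg (by omega), hadv0, hadv1 (by omega)]
    exact this
  · subst hx
    have := pairFun_left_one hr hr' (by linarith) hp hb (by omega)
    rw [if_neg (by omega), if_pos rfl, if_neg (by omega), if_neg (by omega), hadv0,
      hadv1 (by omega)]
    exact this
  · rw [if_neg (by omega), if_neg (by omega)]
    rcases (by omega : y = 0 ∨ y = 1 ∨ 2 ≤ y) with hy | hy | hy
    · subst hy
      have := pairFun_right_zero hr hr' hp ha hx
      rw [if_pos rfl, hadv0, hadv1 (by omega)]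
      exact this
    · subst hy
      have := pairFun_right_one hr hr' hp ha hx
      rw [if_neg (by omega), if_pos rfl, hadv0, hadv1 (by omega)]
      exact this
    · have := pairFun_advance hr hr' ha hb hab' hx hy
      rw [if_neg (by omega), if_neg (by omega)]
      linarith

/-- If the tokens are not themselves the active pair, the ordinary drift inequality suffices: `α =
1-2p` is at most the weight `1-p` of staying, and the other terms are nonnegative. -/
theorem tokenFun_kill (hN : 2 ≤ N) (hα : 0 < α) (hα' : α < 1) {a b : ZMod N} (hab : a ≠ b) :
    α * tokenFun α (a + 1) (b + 1) + 1 ≤ tokenFun α a b := by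
  have : Fact (1 < N) := ⟨hN⟩
  by_cases h : a = 0 ∧ b = 1 ∨ a = 1 ∧ b = 0
  · obtain ⟨hr, hr', hp⟩ := ratio_bounds hα hα'
    have hκ : 2 * ((1 - α) / 2) * (1 / (1 - α)) = 1 := by
      have : 1 - α ≠ 0 := by linarith
      field_simp
    obtain ⟨h1, h2⟩ := pairFun_meet hr hr' hp hκ hN
    have hα2 : 1 - 2 * ((1 - α) / 2) = α := by ring
    have hadv0 : advance N 0 = 1 := if_neg (by omega)
    rw [hα2] at h1 h2
    simp only [tokenFun, val_add_one_eq hN]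
    rcases h with ⟨rfl, rfl⟩ | ⟨rfl, rfl⟩
    · rw [ZMod.val_zero, ZMod.val_one, hadv0]
      exact h1
    · rw [ZMod.val_zero, ZMod.val_one, hadv0]
      exact h2
  · have hd := tokenFun_drift hN hα hα' hab h
    have h1 := tokenFun_nonneg hα hα' (Equiv.swap 0 1 a + 1) (Equiv.swap 0 1 b + 1)
    have h2 := tokenFun_nonneg hα hα' (a + 1) (b + 1)
    have h3 := mul_nonneg (by linarith : 0 ≤ (1 - α) / 2) h1
    have h4 := mul_nonneg (by linarith : 0 ≤ (1 - α) / 2) h2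
    linarith

/-- The best bound on the time to the next compression over all pairs of vertices whose values
differ by at least two. -/
def spreadFun (α : ℝ) (e : ZMod N) (n : ℕ) (X : ZMod N → ℤ) : ℝ≥0∞ :=
  ⨅ (x : ZMod N) (y : ZMod N) (_ : 2 ≤ |X x - X y|),
    ENNReal.ofReal (tokenFun α (x - activeIndex e n) (y - activeIndex e n))

omit [NeZero N] in
theorem spreadFun_le (e : ZMod N) (n : ℕ) {X : ZMod N → ℤ} {x y : ZMod N} (h : 2 ≤ |X x - X y|) :
    spreadFun α e n X ≤
      ENNReal.ofReal (tokenFun α (x - activeIndex e n) (y - activeIndex e n)) :=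
  (iInf_le _ x).trans ((iInf_le _ y).trans (iInf_le _ h))

omit [NeZero N] in
theorem swap_sub (i x : ZMod N) : Equiv.swap i (i + 1) x - i = Equiv.swap 0 1 (x - i) := by
  have h1 : x - i = 1 ↔ x = i + 1 := sub_eq_iff_eq_add'
  simp only [Equiv.swap_apply_def, sub_eq_zero, h1]
  split_ifs <;> simp

/-- Any pair differing by at least two remains one, possibly relabelled, until a compression, so the
drift inequality for each pair passes to the infimum. At TDM states the infimum is empty, hence `∞`,
and nothing is claimed. -/
theorem spreadFun_drift (hN : 2 ≤ N) (hΔ : 0 < Δ) (hα : 0 < α) (hα' : α < 1) (e : ZMod N) (n : ℕ)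
    {X : ZMod N → ℤ} (hX : IsSlotState L X) :
    1 + ∫⁻ u, kill (compressAt e) n X (spreadFun α e (n + 1)) (slotMap L Δ α e n u X)
      ∂ditherLaw Δ ≤ spreadFun α e n X := by
  refine le_iInf fun x => le_iInf fun y => le_iInf fun hxy => ?_
  set i := activeIndex e n with hi
  have hnext : ∀ z : ZMod N, z - activeIndex e (n + 1) = z - i + 1 := fun z => by
    rw [hi, ← activeIndex_succ e n]
    ring
  have hstay : spreadFun α e (n + 1) X ≤
      ENNReal.ofReal (tokenFun α (x - i + 1) (y - i + 1)) := by
    rw [← hnext, ← hnext]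
    exact spreadFun_le e (n + 1) hxy
  have hswap : spreadFun α e (n + 1) (X ∘ Equiv.swap i (i + 1)) ≤
      ENNReal.ofReal (tokenFun α (Equiv.swap 0 1 (x - i) + 1) (Equiv.swap 0 1 (y - i) + 1)) := by
    rw [← swap_sub, ← swap_sub, ← hnext, ← hnext]
    refine spreadFun_le e (n + 1) ?_
    simpa using hxy
  have hab : x - i ≠ y - i := by
    intro h
    rw [sub_left_inj] at h
    subst h
    simp at hxy
  have hs := tokenFun_nonneg hα hα' (x - i + 1) (y - i + 1)
  have hw := tokenFun_nonneg hα hα' (Equiv.swap 0 1 (x - i) + 1) (Equiv.swap 0 1 (y - i) + 1)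
  rcases le_or_gt 2 |X i - X (i + 1)| with hd | hd
  · have hk := lintegral_kill_le_of_two_le hN hΔ hα hα' hX e n (spreadFun α e (n + 1)) hd
    calc _ ≤ ENNReal.ofReal 1 +
          ENNReal.ofReal α * ENNReal.ofReal (tokenFun α (x - i + 1) (y - i + 1)) := by
          rw [ENNReal.ofReal_one]
          exact add_le_add le_rfl (hk.trans (mul_le_mul_right hstay _))
      _ = ENNReal.ofReal (1 + α * tokenFun α (x - i + 1) (y - i + 1)) := by
          rw [ENNReal.ofReal_add zero_le_one (by positivity), ENNReal.ofReal_mul hα.le]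
      _ ≤ _ := ENNReal.ofReal_le_ofReal (by linarith [tokenFun_kill hN hα hα' hab])
  -- The active pair differs by less than two, so it cannot be the pair of tokens.
  · have hne : ¬ (x - i = 0 ∧ y - i = 1 ∨ x - i = 1 ∧ y - i = 0) := by
      rintro (⟨h1, h2⟩ | ⟨h1, h2⟩) <;>
        rw [sub_eq_zero] at * <;> rw [sub_eq_iff_eq_add'] at * <;> subst h1 h2
      · omega
      · rw [abs_sub_comm] at hxy
        omega
    have hdrift := tokenFun_drift hN hα hα' hab hne
    have hp0 : 0 ≤ (1 - α) / 2 := by linarith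
    have hp1 : 0 ≤ 1 - (1 - α) / 2 := by linarith
    have hk : ∫⁻ u, kill (compressAt e) n X (spreadFun α e (n + 1)) (slotMap L Δ α e n u X)
        ∂ditherLaw Δ ≤ ENNReal.ofReal ((1 - α) / 2) *
          spreadFun α e (n + 1) (X ∘ Equiv.swap i (i + 1)) +
          ENNReal.ofReal (1 - (1 - α) / 2) * spreadFun α e (n + 1) X := by
      rcases (by have := abs_nonneg (X i - X (i + 1)); omega :
        |X i - X (i + 1)| = 0 ∨ |X i - X (i + 1)| = 1) with h | h
      · have heq : X i = X (i + 1) := sub_eq_zero.1 (abs_eq_zero.1 h)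
        -- Exchanging equal values changes nothing, so the unit mass may be split as if an exchange
        -- had taken place with probability `(1-α)/2`.
        have hXs : X ∘ Equiv.swap i (i + 1) = X := by
          have hself := update_pair_self X i
          rw [← update_pair_swap, ← heq]
          rwa [← heq] at hself
        rw [hXs, ← add_mul, ← ENNReal.ofReal_add hp0 hp1, add_sub_cancel, ENNReal.ofReal_one,
          one_mul]
        exact lintegral_kill_le_of_eq hN hΔ hα hα' hX e n (spreadFun α e (n + 1)) heq
      · exact lintegral_kill_le_of_abs_eq_one hN hΔ hα hα' hX e n (spreadFun α e (n + 1)) h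
    calc _ ≤ ENNReal.ofReal 1 + (ENNReal.ofReal ((1 - α) / 2) * ENNReal.ofReal
            (tokenFun α (Equiv.swap 0 1 (x - i) + 1) (Equiv.swap 0 1 (y - i) + 1)) +
          ENNReal.ofReal (1 - (1 - α) / 2) *
            ENNReal.ofReal (tokenFun α (x - i + 1) (y - i + 1))) := by
          rw [ENNReal.ofReal_one]
          exact add_le_add le_rfl
            (hk.trans (add_le_add (mul_le_mul_right hswap _) (mul_le_mul_right hstay _)))
      _ = ENNReal.ofReal (1 + ((1 - α) / 2 *
            tokenFun α (Equiv.swap 0 1 (x - i) + 1) (Equiv.swap 0 1 (y - i) + 1) +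
          (1 - (1 - α) / 2) * tokenFun α (x - i + 1) (y - i + 1))) := by
          rw [ENNReal.ofReal_add zero_le_one (by positivity),
            ENNReal.ofReal_add (by positivity) (by positivity), ENNReal.ofReal_mul hp0,
            ENNReal.ofReal_mul hp1]
      _ ≤ _ := ENNReal.ofReal_le_ofReal (by linarith)

/-- The expected time to the next compression is of order `N ^ 3 / (1 - α)`. -/
theorem maxCompression_le {Ω : Type*} [MeasurableSpace Ω] {P : Measure Ω}
    [IsProbabilityMeasure P] {v : ℕ → Ω → ℝ} (hv : IsDither P Δ v) (hN : 2 ≤ N) (hΔ : 0 < Δ)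
    (hα : 0 < α) (hα' : α < 1) (e : ZMod N) (n : ℕ) :
    maxCompression P L Δ α e v n ≤ ENNReal.ofReal (48 * (g α * (N : ℝ) ^ 3)) := by
  rw [maxCompression_eq hv hΔ]
  refine iSup₂_le fun X hX => ?_
  obtain ⟨x, y, hxy⟩ := exists_two_le_of_not_tdm hX.1 hX.2
  refine (expTime_le (measurable_slotMap L Δ α e) (compressAt e) (ditherLaw Δ) (IsSlotState L)
    (spreadFun α e) ?_ (fun n X hX => spreadFun_drift hN hΔ hα hα' e n hX) n X hX.1).trans
    ((spreadFun_le e n hxy).trans (ENNReal.ofReal_le_ofReal (tokenFun_le hN hα hα' _ _)))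
  intro n X hX
  filter_upwards [ae_ditherLaw Δ] with u hu _
  exact (slotStep_cases hN hΔ hα hα' hX _ hu).1

end Tokens

end D3sync

end

/-! ### Assembly of the four claims, with absolute constant `48` -/

theorem mainTheorem3 :
    (∀ (N : ℕ) [NeZero N] (L : ℕ) (Δ α : ℝ), 2 ≤ N → N ≤ L → 0 < Δ → 0 < α → α < 1 →
      -- the potential is bounded on the states
      (∀ q ∈ D3sync.states N L Δ, D3sync.potential Δ q ≤ ((L : ℝ) - N) ^ 2 * N / 4) ∧
      -- it drops by at least two at every compression, and other interactions do not change it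
      (∀ q ∈ D3sync.states N L Δ, ∀ (i : ZMod N), ∀ v ∈ Set.Ioo (-(Δ / 2)) (Δ / 2),
        (D3sync.IsCompression i q (D3sync.step L Δ α i v q) →
          D3sync.potential Δ (D3sync.step L Δ α i v q) ≤ D3sync.potential Δ q - 2) ∧
        (¬ D3sync.IsCompression i q (D3sync.step L Δ α i v q) →
          D3sync.potential Δ (D3sync.step L Δ α i v q) = D3sync.potential Δ q) ∧
        (|q i - q (i + 1)| ≤ Δ → ¬ D3sync.IsCompression i q (D3sync.step L Δ α i v q))) ∧
      -- the bound on the worst expected absorption time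
      (∀ {Ω : Type*} [MeasurableSpace Ω] (P : MeasureTheory.Measure Ω)
        [MeasureTheory.IsProbabilityMeasure P] (v : ℕ → Ω → ℝ), D3sync.IsDither P Δ v →
        ∀ (e : ZMod N) (n₀ : ℕ),
          D3sync.maxAbsorption P L Δ α e v n₀ ≤
            D3sync.maxCompression P L Δ α e v n₀ *
              ENNReal.ofReal (((L : ℝ) - N) ^ 2 * N / 8))) ∧
    -- the resulting orders of growth, with one absolute constant
    (∃ C : ℝ, 0 < C ∧
      ∀ (N : ℕ) [NeZero N] (L : ℕ) (Δ α : ℝ), 2 ≤ N → N ≤ L → 0 < Δ → 0 < α → α < 1 →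
        ∀ {Ω : Type*} [MeasurableSpace Ω] (P : MeasureTheory.Measure Ω)
          [MeasureTheory.IsProbabilityMeasure P] (v : ℕ → Ω → ℝ), D3sync.IsDither P Δ v →
          ∀ (e : ZMod N) (n₀ : ℕ),
            D3sync.maxCompression P L Δ α e v n₀ ≤
              ENNReal.ofReal (C * (D3sync.g α * (N : ℝ) ^ 3)) ∧
            D3sync.maxAbsorption P L Δ α e v n₀ ≤
              ENNReal.ofReal (C * (D3sync.g α * ((L : ℝ) - N) ^ 2 * (N : ℝ) ^ 4 / 8))) := by
  refine ⟨fun N _ L Δ α hN hL hΔ hα hα' => ⟨fun q hq => ?_, fun q hq i v hv =>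
    D3sync.step_potential hN hΔ hα hα' hq i hv, fun P _ v hv e n =>
    D3sync.maxAbsorption_le hv hN hΔ hα hα' e n⟩, 48, by norm_num,
    fun N _ L Δ α hN hL hΔ hα hα' _ _ P _ v hv e n =>
      ⟨D3sync.maxCompression_le hv hN hΔ hα hα' e n, ?_⟩⟩
  · obtain ⟨X, hX, rfl⟩ := D3sync.exists_scale_eq hΔ hq
    exact D3sync.potential_scale_le hN hΔ hX
  · have hg : 0 ≤ D3sync.g α := div_nonneg (by linarith) (by linarith)
    refine (D3sync.maxAbsorption_le hv hN hΔ hα hα' e n).trans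
      ((mul_le_mul_left (D3sync.maxCompression_le hv hN hΔ hα hα' e n) _).trans_eq ?_)
    rw [← ENNReal.ofReal_mul (by positivity)]
    congr 1
    ring
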